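/- Fix a type universe $\mathrm{Type}\ u$ and let $\mathbb{B} : \mathrm{Type}\ u$ be a complete Boolean algebra. Pre-sets are the terms of the inductive type $\mathtt{pSet}$ with constructor $\langle \alpha, A\rangle$, $\alpha : \mathrm{Type}\ u$, $A : \alpha \to \mathtt{pSet}$, considered up to extensional equivalence. $\mathbb{B}$-valued sets are the terms of the inductive type $\mathtt{bSet}\,\mathbb{B}$ with constructor $\langle \alpha, A, b\rangle$, $\alpha : \mathrm{Type}\ u$, $A : \alpha \to \mathtt{bSet}\,\mathbb{B}$, $b : \alpha \to \mathbb{B}$. Boolean-valued equality and membership are given by $$[\![\langle\alpha,A,b\rangle = \langle\alpha',A',b'\rangle]\!] = \bigsqcap_{a}\Big(b(a) \Rightarrow \bigsqcup_{a'} b'(a')\sqcap [\![A(a)=A'(a')]\!]\Big)\sqcap\bigsqcap_{a'}\Big(b'(a') \Rightarrow \bigsqcup_{a} b(a)\sqcap [\![A(a)=A'(a')]\!]\Big),$$ $$[\![x \in \langle\alpha,A,b\rangle]\!] = \bigsqcup_{a} b(a) \sqcap [\![x = A(a)]\!],$$ and the truth value $[\![\varphi]\!]\in\mathbb{B}$ of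 a set-theoretic statement $\varphi$ about $\mathbb{B}$-valued sets is obtained by interpreting connectives and quantifiers by the operations of $\mathbb{B}$; $\mathtt{bSet}\,\mathbb{B}$ models $\varphi$ if $[\![\varphi]\!] = \top$. The check-name of a pre-set is $\langle\alpha,A\rangle^{\vee} = \langle \alpha, a\mapsto A(a)^{\vee}, a \mapsto \top\rangle$, and $\omega$ in $\mathtt{bSet}\,\mathbb{B}$ is $\check\omega$. The internal power set of $x=\langle\alpha,A,b\rangle$ is $\mathcal{P}(x) = \langle \alpha\to\mathbb{B},\ \chi\mapsto\tilde\chi,\ \chi\mapsto[\![\tilde\chi\subseteq x]\!]\rangle$, where $\tilde\chi=\langle\alpha,A,\chi\rangle$. The internal $\aleph_1^{\mathbb{B}}$ is the Hartogs number of $\omega$ constructed in $\mathtt{bSet}\,\mathbb{B}$: to each $R$ in the underlying type of $\mathcal{P}(\omega\times\omega)$ one attaches the truth value of "$R \subseteq \omega\times\omega$, and there are an ordinal $\eta$ and an injection $f:\eta\hookrightarrow\omega$ such that $R$ is the image under $f$ of the membership relation of $\eta$", and a name $\eta_R$ (chosen by the maximum principle) for which the supremum over $\eta$ of these truth values is attained;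 $\aleph_1^{\mathbb{B}}$ consists of the $\eta_R$ with these truth values, together with $0$ and $1$ with truth value $\top$. The ground-universe $\aleph_1$ is the von Neumann ordinal in $\mathtt{pSet}$ of the first uncountable ordinal of the universe. Say that $\mathtt{bSet}\,\mathbb{B}$ reflects countable functions if, for every pre-set $y$ and every $f : \mathtt{bSet}\,\mathbb{B}$ such that $\mathtt{bSet}\,\mathbb{B}$ models "$f$ is a function from $\omega$ to $\check y$", it is true in $\mathtt{bSet}\,\mathbb{B}$ that $f$ is the check-name of some function from $\omega$ to $y$ in $\mathtt{pSet}$, i.e. $$\bigsqcup\big\{\,[\![\check g = f]\!] \;:\; g\in\mathtt{pSet} \text{ is a function from } \omega \text{ to } y\,\big\} = \top .$$ Suppose that $\mathtt{bSet}\,\mathbb{B}$ reflects countable functions. Then $$[\![\,\mathcal{P}(\omega)^{\vee} = \mathcal{P}(\check\omega)\,]\!] = \top \qquad\text{and}\qquad [\![\,\check\aleph_1 = \aleph_1^{\mathbb{B}}\,]\!] = \top .$$ -/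

import Mathlib

universe u

/-- `𝔹`-valued sets (`𝔹`-names): families of `𝔹`-valued sets indexed by a small type, each member
carrying a truth value in `𝔹`. -/
inductive BSet (𝔹 : Type u) : Type (u + 1)
  | mk (α : Type u) (A : α → BSet 𝔹) (b : α → 𝔹) : BSet 𝔹

namespace BSet

section Basic

variable {𝔹 : Type u}

/-- The index type of a `𝔹`-valued set. -/
def type : BSet 𝔹 → Type u
  | ⟨α, _, _⟩ => α

/-- The members of a `𝔹`-valued set. -/
def func : (x : BSet 𝔹) → x.type → BSet 𝔹
  | ⟨_, A, _⟩ => A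

/-- The truth values attached to the members of a `𝔹`-valued set. -/
def bval : (x : BSet 𝔹) → x.type → 𝔹
  | ⟨_, _, b⟩ => b

end Basic

variable {𝔹 : Type u} [CompleteBooleanAlgebra 𝔹]

/-- Boolean-valued equality. -/
def bvEq : BSet 𝔹 → BSet 𝔹 → 𝔹
  | ⟨_, A, b⟩, ⟨_, A', b'⟩ =>
    (⨅ a, b a ⇨ ⨆ a', b' a' ⊓ bvEq (A a) (A' a')) ⊓
    (⨅ a', b' a' ⇨ ⨆ a, b a ⊓ bvEq (A a) (A' a'))

infix:70 " =ᴮ " => BSet.bvEq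

/-- Boolean-valued membership. -/
def bvMem (x y : BSet 𝔹) : 𝔹 := ⨆ a, y.bval a ⊓ x =ᴮ y.func a

infix:70 " ∈ᴮ " => BSet.bvMem

/-- Boolean-valued inclusion. -/
def bvSubset (x y : BSet 𝔹) : 𝔹 := ⨅ z, z ∈ᴮ x ⇨ z ∈ᴮ y

infix:70 " ⊆ᴮ " => BSet.bvSubset

/-- The canonical name of a pre-set. -/
def check : PSet.{u} → BSet 𝔹
  | ⟨α, A⟩ => ⟨α, fun a => check (A a), fun _ => ⊤⟩

/-- The natural numbers of `BSet 𝔹`. -/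
def omega : BSet 𝔹 := check PSet.omega

/-- The name `χ̃`, with the members of `x` and the truth values given by `χ`. -/
def setOfIndicator (x : BSet 𝔹) (χ : x.type → 𝔹) : BSet 𝔹 := ⟨x.type, x.func, χ⟩

/-- The internal power set. -/
def powerset (x : BSet 𝔹) : BSet 𝔹 :=
  ⟨x.type → 𝔹, fun χ => setOfIndicator x χ, fun χ => setOfIndicator x χ ⊆ᴮ x⟩

/-- The internal unordered pair `{x, y}`. -/
def upair (x y : BSet 𝔹) : BSet 𝔹 :=
  ⟨ULift.{u} Bool, fun i => if i.down then x else y, fun _ => ⊤⟩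

/-- The internal (Kuratowski) ordered pair `{{x}, {x, y}}`. -/
def pair (x y : BSet 𝔹) : BSet 𝔹 := upair (upair x x) (upair x y)

/-- The internal cartesian product. -/
def prod (x y : BSet 𝔹) : BSet 𝔹 :=
  ⟨x.type × y.type, fun p => pair (x.func p.1) (y.func p.2), fun p => x.bval p.1 ⊓ y.bval p.2⟩

/-- `{x} ∪ y`. -/
def insert (x y : BSet 𝔹) : BSet 𝔹 :=
  ⟨Option y.type, fun o => o.elim x y.func, fun o => o.elim ⊤ y.bval⟩

/-- Separation: `{z ∈ x | φ z}`. -/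
def comprehension (φ : BSet 𝔹 → 𝔹) (x : BSet 𝔹) : BSet 𝔹 :=
  ⟨x.type, x.func, fun a => x.bval a ⊓ φ (x.func a)⟩

/-- The truth value of "`f` is a function from `x` to `y`": `f` is a set of pairs `(a, b)` with
`a ∈ x` and `b ∈ y`, and for every `a ∈ x` there is exactly one `b` with `(a, b) ∈ f`. -/
def isFunc (x y f : BSet 𝔹) : 𝔹 :=
  (⨅ z, z ∈ᴮ f ⇨ ⨆ a, ⨆ b, a ∈ᴮ x ⊓ b ∈ᴮ y ⊓ z =ᴮ pair a b) ⊓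
  (⨅ a, a ∈ᴮ x ⇨ ⨆ b, pair a b ∈ᴮ f ⊓ ⨅ b', pair a b' ∈ᴮ f ⇨ b' =ᴮ b)

/-- The truth value of "`f` is an injective function from `x` to `y`". -/
def isInj (x y f : BSet 𝔹) : 𝔹 :=
  isFunc x y f ⊓ ⨅ a, ⨅ a', ⨅ b, pair a b ∈ᴮ f ⊓ pair a' b ∈ᴮ f ⇨ a =ᴮ a'

/-- The truth value of "`x` is transitive". -/
def isTransitive (x : BSet 𝔹) : 𝔹 := ⨅ y, y ∈ᴮ x ⇨ y ⊆ᴮ x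

/-- The truth value of "any two elements of `x` are comparable under membership". -/
def isTrichotomous (x : BSet 𝔹) : 𝔹 :=
  ⨅ y, ⨅ z, y ∈ᴮ x ⊓ z ∈ᴮ x ⇨ y =ᴮ z ⊔ y ∈ᴮ z ⊔ z ∈ᴮ y

/-- The truth value of "every non-empty subset of `x` has a membership-minimal element". -/
def isWellFounded (x : BSet 𝔹) : 𝔹 :=
  ⨅ y, y ⊆ᴮ x ⇨ (y =ᴮ check ∅)ᶜ ⇨ ⨆ z, z ∈ᴮ y ⊓ ⨅ w, w ∈ᴮ y ⇨ (w ∈ᴮ z)ᶜ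

/-- The truth value of "`x` is an ordinal". -/
def isOrd (x : BSet 𝔹) : 𝔹 := isTrichotomous x ⊓ isWellFounded x ⊓ isTransitive x

/-- The truth value of "`R` is the image under `f` of the membership relation of `η`". -/
def isMemImage (η f R : BSet 𝔹) : 𝔹 :=
  ⨅ z, bihimp (z ∈ᴮ R) (⨆ a, ⨆ b, ⨆ m, ⨆ n,
    a ∈ᴮ η ⊓ b ∈ᴮ η ⊓ a ∈ᴮ b ⊓ pair a m ∈ᴮ f ⊓ pair b n ∈ᴮ f ⊓ z =ᴮ pair m n)

/-- The truth value of "`η` is an ordinal and there is an injection of `η` into `ω` under which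
the image of the membership relation of `η` is `R`". -/
def codes (R η : BSet 𝔹) : 𝔹 := isOrd η ⊓ ⨆ f, isInj η omega f ⊓ isMemImage η f R

/-! ### The maximum principle, which selects witnesses for existential statements -/

theorem bvEq_def (x y : BSet 𝔹) : x =ᴮ y =
    (⨅ a, x.bval a ⇨ x.func a ∈ᴮ y) ⊓
    (⨅ a', y.bval a' ⇨ ⨆ a, x.bval a ⊓ x.func a =ᴮ y.func a') := by
  cases x; cases y; rw [bvEq]; rfl

theorem bvEq_refl (x : BSet 𝔹) : x =ᴮ x = ⊤ := by
  induction x with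
  | mk α A b ih =>
    rw [eq_top_iff, bvEq]
    refine le_inf (le_iInf fun a => ?_) (le_iInf fun a => ?_) <;>
    · rw [le_himp_iff, top_inf_eq]
      exact le_iSup_of_le a (by rw [ih, inf_top_eq])

theorem bvEq_symm (x y : BSet 𝔹) : x =ᴮ y = y =ᴮ x := by
  induction x generalizing y with
  | mk α A b ih =>
    cases y with
    | mk α' A' b' => rw [bvEq, bvEq, inf_comm]; simp only [ih]

theorem bvEq_left {x y : BSet 𝔹} (a : x.type) : x =ᴮ y ⊓ x.bval a ≤ x.func a ∈ᴮ y := by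
  rw [bvEq_def, ← le_himp_iff]
  exact inf_le_left.trans (iInf_le _ a)

theorem bvEq_trans (x y z : BSet 𝔹) : x =ᴮ y ⊓ y =ᴮ z ≤ x =ᴮ z := by
  induction x generalizing y z with
  | mk α A b ih =>
    have key : ∀ y z : BSet 𝔹, ∀ a, BSet.mk α A b =ᴮ y ⊓ y =ᴮ z ⊓ b a ≤ A a ∈ᴮ z := by
      intro y z a
      have h1 : BSet.mk α A b =ᴮ y ⊓ b a ≤ A a ∈ᴮ y := bvEq_left (x := BSet.mk α A b) a
      calc BSet.mk α A b =ᴮ y ⊓ y =ᴮ z ⊓ b a ≤ y =ᴮ z ⊓ A a ∈ᴮ y :=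
            le_inf (inf_le_left.trans inf_le_right)
              ((inf_le_inf_right _ inf_le_left).trans h1)
        _ ≤ A a ∈ᴮ z := by
          conv_lhs => rw [bvMem]
          rw [inf_iSup_eq]
          refine iSup_le fun c => ?_
          have h2 : y =ᴮ z ⊓ y.bval c ≤ y.func c ∈ᴮ z := bvEq_left c
          rw [← inf_assoc]
          refine (inf_le_inf_right _ h2).trans ?_
          rw [bvMem, iSup_inf_eq]
          refine iSup_le fun d => le_iSup_of_le d ?_
          rw [inf_assoc, inf_comm (y.func c =ᴮ _)]
          exact inf_le_inf_left _ (ih a _ _)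
    rw [bvEq_def (BSet.mk α A b) z]
    refine le_inf (le_iInf fun a => le_himp_iff.2 (key y z a)) (le_iInf fun c => ?_)
    rw [le_himp_iff]
    have h3 : z =ᴮ y ⊓ z.bval c ≤ z.func c ∈ᴮ y := bvEq_left c
    have h4 : BSet.mk α A b =ᴮ y ⊓ y =ᴮ z ⊓ z.bval c ≤
        y =ᴮ BSet.mk α A b ⊓ z.func c ∈ᴮ y := by
      refine le_inf ?_ ?_
      · exact (inf_le_left.trans inf_le_left).trans (bvEq_symm _ _).le
      · exact (inf_le_inf_right _ (inf_le_right.trans (bvEq_symm y z).le)).trans h3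
    refine h4.trans ?_
    conv_lhs => rw [bvMem]
    rw [inf_iSup_eq]
    refine iSup_le fun d => ?_
    have h5 : y =ᴮ BSet.mk α A b ⊓ y.bval d ≤ y.func d ∈ᴮ BSet.mk α A b := bvEq_left d
    rw [← inf_assoc]
    refine (inf_le_inf_right _ h5).trans ?_
    rw [bvMem, iSup_inf_eq]
    refine iSup_le fun a => le_iSup_of_le a ?_
    rw [inf_assoc]
    refine inf_le_inf_left _ ?_
    rw [bvEq_symm (y.func d), bvEq_symm (z.func c)]
    exact ih a _ _

/-- A `𝔹`-valued predicate is extensional if it respects Boolean-valued equality. -/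
def BExt (φ : BSet 𝔹 → 𝔹) : Prop := ∀ x y, x =ᴮ y ⊓ φ x ≤ φ y

theorem BExt.const (b : 𝔹) : BExt fun _ : BSet 𝔹 => b := fun _ _ => inf_le_right

theorem BExt.mem_left (z : BSet 𝔹) : BExt fun x => x ∈ᴮ z := by
  intro x y
  simp only [bvMem, inf_iSup_eq]
  refine iSup_mono fun a => ?_
  rw [inf_left_comm, bvEq_symm x y]
  exact inf_le_inf_left _ (bvEq_trans _ _ _)

theorem BExt.mem_right (z : BSet 𝔹) : BExt fun x => z ∈ᴮ x := by
  intro x y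
  change x =ᴮ y ⊓ ⨆ a, x.bval a ⊓ z =ᴮ x.func a ≤ z ∈ᴮ y
  rw [inf_iSup_eq]
  refine iSup_le fun a => ?_
  rw [← inf_assoc]
  refine (inf_le_inf_right _ (bvEq_left a)).trans ?_
  rw [inf_comm, bvEq_symm]
  exact BExt.mem_left y _ _

theorem BExt.inf {φ ψ : BSet 𝔹 → 𝔹} (h : BExt φ) (h' : BExt ψ) : BExt fun x => φ x ⊓ ψ x :=
  fun x y => le_inf ((inf_le_inf_left _ inf_le_left).trans (h x y))
    ((inf_le_inf_left _ inf_le_right).trans (h' x y))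

theorem BExt.himp {φ ψ : BSet 𝔹 → 𝔹} (h : BExt φ) (h' : BExt ψ) : BExt fun x => φ x ⇨ ψ x := by
  intro x y
  rw [le_himp_iff]
  refine le_trans (le_inf (inf_le_left.trans inf_le_left) ?_) (h' x y)
  calc x =ᴮ y ⊓ (φ x ⇨ ψ x) ⊓ φ y ≤ (φ x ⇨ ψ x) ⊓ φ x :=
        le_inf (inf_le_left.trans inf_le_right)
          ((inf_le_inf_right _ (inf_le_left.trans (bvEq_symm x y).le)).trans (h y x))
    _ ≤ ψ x := himp_inf_le

theorem BExt.iInf {ι : Sort*} {φ : ι → BSet 𝔹 → 𝔹} (h : ∀ i, BExt (φ i)) :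
    BExt fun x => ⨅ i, φ i x :=
  fun x y => le_iInf fun i => (inf_le_inf_left _ (iInf_le _ i)).trans (h i x y)

theorem BExt.iSup {ι : Sort*} {φ : ι → BSet 𝔹 → 𝔹} (h : ∀ i, BExt (φ i)) :
    BExt fun x => ⨆ i, φ i x := by
  intro x y
  rw [inf_iSup_eq]
  exact iSup_mono fun i => h i x y

theorem BExt.bihimp {φ ψ : BSet 𝔹 → 𝔹} (h : BExt φ) (h' : BExt ψ) :
    BExt fun x => _root_.bihimp (φ x) (ψ x) :=
  (h'.himp h).inf (h.himp h')

theorem BExt.isOrd : BExt fun x : BSet 𝔹 => BSet.isOrd x := by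
  refine ((BExt.iInf fun y => .iInf fun z => ?_).inf (.iInf fun y => ?_)).inf (.iInf fun y => ?_)
  · exact ((mem_right y).inf (mem_right z)).himp (.const _)
  · exact (BExt.iInf fun z => (BExt.const _).himp (mem_right z)).himp (.const _)
  · exact (mem_right y).himp (.iInf fun z => (BExt.const _).himp (mem_right z))

theorem BExt.codes (R : BSet 𝔹) : BExt (BSet.codes R) := by
  refine BExt.isOrd.inf (.iSup fun f => ((BExt.inf ?_ ?_).inf (.const _)).inf ?_)
  · exact .iInf fun z => (BExt.const _).himp (.iSup fun a => .iSup fun b =>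
      ((mem_right a).inf (.const _)).inf (.const _))
  · exact .iInf fun a => (mem_right a).himp (.const _)
  · exact .iInf fun z => (BExt.const _).bihimp (.iSup fun a => .iSup fun b => .iSup fun m =>
      .iSup fun n => (((((mem_right a).inf (mem_right b)).inf (.const _)).inf (.const _)).inf
        (.const _)).inf (.const _))

/-- Mixing a family of names along an antichain of truth values. -/
theorem exists_mixture {ι : Type u} (c : ι → 𝔹) (x : ι → BSet 𝔹)
    (hc : ∀ i j, i ≠ j → c i ⊓ c j = ⊥) : ∃ v : BSet 𝔹, ∀ i, c i ≤ v =ᴮ x i := by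
  refine ⟨⟨Σ i, (x i).type, fun p => (x p.1).func p.2, fun p => c p.1 ⊓ (x p.1).bval p.2⟩,
    fun i => ?_⟩
  rw [bvEq_def]
  refine le_inf (le_iInf ?_) (le_iInf fun t => ?_)
  · rintro ⟨j, t⟩
    rw [le_himp_iff]
    change c i ⊓ (c j ⊓ (x j).bval t) ≤ (x j).func t ∈ᴮ x i
    by_cases hij : i = j
    · subst hij
      exact le_iSup_of_le t (by rw [bvEq_refl, inf_top_eq]; exact inf_le_right.trans inf_le_right)
    · rw [← inf_assoc, hc i j hij, bot_inf_eq]; exact bot_le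
  · rw [le_himp_iff]
    refine le_iSup_of_le (⟨i, t⟩ : Σ i, (x i).type) ?_
    change c i ⊓ (x i).bval t ≤ (c i ⊓ (x i).bval t) ⊓ (x i).func t =ᴮ (x i).func t
    rw [bvEq_refl, inf_top_eq]

theorem maximum_principle (φ : BSet 𝔹 → 𝔹) (h : BExt φ) : ∃ v, φ v = ⨆ x, φ x := by
  classical
  let x : 𝔹 → BSet 𝔹 := fun b => if hb : ∃ y, φ y = b then hb.choose else check ∅
  have hx : ∀ y, φ (x (φ y)) = φ y := fun y => by
    have hb : ∃ z, φ z = φ y := ⟨y, rfl⟩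
    simp only [x, dif_pos hb]
    exact hb.choose_spec
  let lt : 𝔹 → 𝔹 → Prop := WellOrderingRel
  let c : 𝔹 → 𝔹 := fun b => φ (x b) ⊓ (⨆ d : {d // lt d b}, φ (x d))ᶜ
  have hlt : ∀ i j, lt i j → c i ⊓ c j = ⊥ := fun i j hij => by
    rw [eq_bot_iff]
    calc c i ⊓ c j ≤ (⨆ d : {d // lt d j}, φ (x d)) ⊓ (⨆ d : {d // lt d j}, φ (x d))ᶜ :=
          inf_le_inf (inf_le_left.trans
            (le_iSup (fun d : {d // lt d j} => φ (x d)) ⟨i, hij⟩)) inf_le_right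
      _ ≤ ⊥ := inf_compl_eq_bot.le
  have hc : ∀ i j, i ≠ j → c i ⊓ c j = ⊥ := fun i j hij => by
    rcases trichotomous_of (WellOrderingRel (α := 𝔹)) i j with h1 | h1 | h1
    · exact hlt i j h1
    · exact absurd h1 hij
    · rw [inf_comm]; exact hlt j i h1
  obtain ⟨v, hv⟩ := exists_mixture c x hc
  have hcv : ∀ b, c b ≤ φ v := fun b =>
    (le_inf ((hv b).trans (bvEq_symm _ _).le) inf_le_left).trans (h (x b) v)
  have hav : ∀ b, φ (x b) ≤ φ v := fun b => by
    induction b using (IsWellFounded.wf (r := WellOrderingRel (α := 𝔹))).induction with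
    | _ b ih =>
      have h1 : (⨆ d : {d // lt d b}, φ (x d)) ≤ φ v := iSup_le fun d => ih d.1 d.2
      calc φ (x b) = φ (x b) ⊓ (⨆ d : {d // lt d b}, φ (x d)) ⊔ c b := by
            rw [← inf_sup_left, sup_compl_eq_top, inf_top_eq]
        _ ≤ φ v := sup_le (inf_le_right.trans h1) (hcv b)
  exact ⟨v, le_antisymm (le_iSup φ v) (iSup_le fun y => (hx y).symm.le.trans (hav _))⟩

/-! ### The internal `ℵ₁` -/

/-- A name `η` at which "`R` codes `η`" attains the truth value of "`R` codes some ordinal". -/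
noncomputable def codedOrd (R : BSet 𝔹) : BSet 𝔹 :=
  (maximum_principle (codes R) (BExt.codes R)).choose

/-- The set of all `R ⊆ ω × ω` that code some ordinal. -/
def alephOneAux : BSet 𝔹 := comprehension (fun R => ⨆ η, codes R η) (powerset (prod omega omega))

/-- The internal `ℵ₁` of `BSet 𝔹`, as the Hartogs number of `ω`: the ordinals that inject into `ω`.
They are obtained as the ordinals coded by the relations on `ω`; since `0` and `1` have the same
(empty) membership relation, these two are inserted by hand. -/
noncomputable def alephOne : BSet 𝔹 :=
  insert (check (PSet.ofNat 0)) <| insert (check (PSet.ofNat 1))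
    ⟨(alephOneAux (𝔹 := 𝔹)).type, fun R => codedOrd (alephOneAux.func R), alephOneAux.bval⟩

/-! ### Reflection of countable functions -/

/-- For `f` a function from `ω` to `y̌` in `BSet 𝔹`: it is true in `BSet 𝔹` that `f` equals the
canonical name `ǧ` of some function `g` from `ω` to `y` in the ground universe of pre-sets.
The existential quantifier over `g` is interpreted in `BSet 𝔹`, as the supremum of the truth
values of `ǧ = f`. -/
def Reflects (y : PSet.{u}) (f : BSet 𝔹) : Prop :=
  (⨆ g : {g : PSet.{u} // ZFSet.IsFunc ZFSet.omega (ZFSet.mk y) (ZFSet.mk g)},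
    check g.1 =ᴮ f) = ⊤

variable (𝔹) in
/-- Every function from `ω` to a canonical name `y̌` in `BSet 𝔹` is reflected. -/
def ReflectsCountableFunctions : Prop :=
  ∀ (y : PSet.{u}) (f : BSet 𝔹), isFunc omega (check y) f = ⊤ → Reflects y f

end BSet

namespace BSet

variable {𝔹 : Type u} [CompleteBooleanAlgebra 𝔹]

/-! ### Reasoning below a truth value -/

section Logic

variable {Γ a b c : 𝔹}

/-! Reflection makes `𝔹` decide countably many statements at once. A sequence `c : ℕ → 𝔹` is the
same as a name for a function from `ω` to `2`. Reflection says that the truth values at which this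
name equals a canonical `ǧ` have supremum `⊤`, and below each of them every `c n` is either forced
or refuted, according to `g`. To prove `Γ ≤ d`, one may therefore assume that any given countable
family is decided by a ground predicate (`le_of_decide`).

For the power set, deciding the values of an indicator on `ω` turns an internal subset of `ω` into
the canonical name of a ground subset.

For `ℵ₁`, let `f` inject an internal ordinal `η` into `ω`. Once the transported membership relation
and the range of `f` are decided, they are a ground relation `S` and a ground set `D`. Internal
foundation makes `S` well-founded in the ground, and the Mostowski collapse of `S` on `D` is a
ground set whose canonical name equals `η` (`Decides.eq_collapseSet`). It is a countable ordinal by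
absoluteness, so `η` belongs to the canonical name of `ℵ₁`. Conversely, a countable ground ordinal
greater than `1` is coded by a nonempty ground relation on `ℕ`. The same collapse argument shows
that such a relation codes only one ordinal (`le_eq_of_le_codes`), so the name chosen by the maximum
principle is the expected one.

Throughout, a truth value `Γ` serves as a context: `Γ ≤ φ` reads "`φ` holds under `Γ`", and passing
to `Δ ≤ Γ` adds assumptions. Distributivity then eliminates existentials and disjunctions. -/

theorem le_of_le_iSup {ι : Sort*} {φ : ι → 𝔹} (h : Γ ≤ ⨆ i, φ i)
    (H : ∀ i, ∀ Δ ≤ Γ, Δ ≤ φ i → Δ ≤ c) : Γ ≤ c := by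
  rw [← inf_eq_left.2 h, inf_iSup_eq]
  exact iSup_le fun i => H i _ inf_le_left inf_le_right

theorem le_of_le_sup (h : Γ ≤ a ⊔ b) (ha : ∀ Δ ≤ Γ, Δ ≤ a → Δ ≤ c)
    (hb : ∀ Δ ≤ Γ, Δ ≤ b → Δ ≤ c) : Γ ≤ c := by
  rw [← inf_eq_left.2 h, inf_sup_left]
  exact sup_le (ha _ inf_le_left inf_le_right) (hb _ inf_le_left inf_le_right)

theorem le_himp_of (H : ∀ Δ ≤ Γ, Δ ≤ a → Δ ≤ b) : Γ ≤ a ⇨ b :=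
  le_himp_iff.2 (H _ inf_le_left inf_le_right)

theorem le_of_le_himp (h : Γ ≤ a ⇨ b) (ha : Γ ≤ a) : Γ ≤ b :=
  (le_inf h ha).trans himp_inf_le

theorem le_compl_of (H : ∀ Δ ≤ Γ, Δ ≤ a → Δ ≤ ⊥) : Γ ≤ aᶜ := by
  rw [← himp_bot]; exact le_himp_of H

theorem le_of_le_compl (h : Γ ≤ aᶜ) (ha : Γ ≤ a) : Γ ≤ c :=
  ((le_inf ha h).trans inf_compl_eq_bot.le).trans bot_le

end Logic

/-! ### Equality and membership -/

variable {Γ : 𝔹} {x y z w : BSet 𝔹}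

theorem le_bvEq_refl (x : BSet 𝔹) : Γ ≤ x =ᴮ x := by rw [bvEq_refl]; exact le_top

theorem le_bvEq_symm (h : Γ ≤ x =ᴮ y) : Γ ≤ y =ᴮ x := by rwa [bvEq_symm]

theorem le_bvEq_trans (h : Γ ≤ x =ᴮ y) (h' : Γ ≤ y =ᴮ z) : Γ ≤ x =ᴮ z :=
  (le_inf h h').trans (bvEq_trans _ _ _)

theorem le_mem_of_eq_left (h : Γ ≤ x =ᴮ y) (h' : Γ ≤ x ∈ᴮ z) : Γ ≤ y ∈ᴮ z :=
  (le_inf h h').trans (BExt.mem_left z _ _)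

theorem le_mem_of_eq_right (h : Γ ≤ x =ᴮ y) (h' : Γ ≤ z ∈ᴮ x) : Γ ≤ z ∈ᴮ y :=
  (le_inf h h').trans (BExt.mem_right z _ _)

theorem le_of_le_mem {c : 𝔹} (h : Γ ≤ z ∈ᴮ y)
    (H : ∀ i, ∀ Δ ≤ Γ, Δ ≤ y.bval i → Δ ≤ z =ᴮ y.func i → Δ ≤ c) : Γ ≤ c :=
  le_of_le_iSup h fun i Δ hΔ hi => H i Δ hΔ (hi.trans inf_le_left) (hi.trans inf_le_right)

theorem le_mem_of (i : y.type) (h : Γ ≤ y.bval i) (h' : Γ ≤ z =ᴮ y.func i) : Γ ≤ z ∈ᴮ y :=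
  le_iSup_of_le i (le_inf h h')

theorem le_bvEq_of (H : ∀ z, ∀ Δ ≤ Γ, Δ ≤ z ∈ᴮ x → Δ ≤ z ∈ᴮ y)
    (H' : ∀ z, ∀ Δ ≤ Γ, Δ ≤ z ∈ᴮ y → Δ ≤ z ∈ᴮ x) : Γ ≤ x =ᴮ y := by
  rw [bvEq_def]
  refine le_inf (le_iInf fun i => le_himp_of fun Δ hΔ hi => ?_)
    (le_iInf fun i => le_himp_of fun Δ hΔ hi => ?_)
  · exact H _ Δ hΔ (le_mem_of i hi (le_bvEq_refl _))
  · refine le_of_le_mem (H' _ Δ hΔ (le_mem_of i hi (le_bvEq_refl _))) fun j Δ' hΔ' h1 h2 => ?_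
    exact le_iSup_of_le j (le_inf h1 (le_bvEq_symm h2))

theorem le_subset_of (H : ∀ z, ∀ Δ ≤ Γ, Δ ≤ z ∈ᴮ x → Δ ≤ z ∈ᴮ y) : Γ ≤ x ⊆ᴮ y :=
  le_iInf fun z => le_himp_of (H z)

theorem le_mem_of_subset (h : Γ ≤ x ⊆ᴮ y) (hz : Γ ≤ z ∈ᴮ x) : Γ ≤ z ∈ᴮ y :=
  le_of_le_himp (h.trans (iInf_le _ z)) hz

/-- Membership induction in `BSet 𝔹`. -/
theorem le_of_mem_induction (φ : BSet 𝔹 → 𝔹)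
    (H : ∀ x, ∀ Δ ≤ Γ, (∀ y, ∀ Δ' ≤ Δ, Δ' ≤ y ∈ᴮ x → Δ' ≤ φ y) → Δ ≤ φ x) (x : BSet 𝔹) :
    Γ ≤ φ x := by
  -- The claim is widened from `x` to all names equal to `x` under some `Δ`: a member of `x` is only
  -- known to equal some `A i`, and `φ` need not be extensional.
  suffices h : ∀ y, ∀ Δ ≤ Γ, Δ ≤ y =ᴮ x → Δ ≤ φ y from h x Γ le_rfl (le_bvEq_refl x)
  induction x with
  | mk α A b ih =>
    intro y Δ hΔ hy
    refine H y Δ hΔ fun z Δ' hΔ' hz => ?_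
    refine le_of_le_mem (le_mem_of_eq_right (hΔ'.trans hy) hz) fun i Δ₂ h₂ _ h₃ => ?_
    exact ih i z Δ₂ (h₂.trans (hΔ'.trans hΔ)) h₃

/-- If `y` had no minimal element, membership induction would exclude every `z` from `y`, making `y`
empty. -/
theorem isWellFounded_eq_top (x : BSet 𝔹) : isWellFounded x = ⊤ := by
  rw [eq_top_iff]
  refine le_iInf fun y => le_himp_of fun Γ _ _ => le_himp_of fun Γ' hΓ' hne => ?_
  set c := ⨆ z, z ∈ᴮ y ⊓ ⨅ w, w ∈ᴮ y ⇨ (w ∈ᴮ z)ᶜ with hc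
  have key : Γ' ⊓ cᶜ ≤ y =ᴮ check ∅ := by
    refine le_bvEq_of (fun z Δ hΔ hz => ?_) (fun z Δ hΔ hz => ?_)
    · refine le_of_le_compl (a := z ∈ᴮ y) ?_ hz
      refine hΔ.trans (le_of_mem_induction (fun z => (z ∈ᴮ y)ᶜ) (fun z Δ hΔ ih => ?_) z)
      refine le_compl_of fun Δ' hΔ' hz => ?_
      refine le_of_le_compl (a := c) (hΔ'.trans (hΔ.trans inf_le_right)) ?_
      refine le_iSup_of_le z (le_inf hz (le_iInf fun w => le_himp_of fun Δ₂ h₂ hw =>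
        le_compl_of fun Δ₃ h₃ hwz => ?_))
      exact le_of_le_compl (ih w Δ₃ (h₃.trans (h₂.trans hΔ')) hwz) (h₃.trans hw)
    · exact le_of_le_mem hz fun i => nomatch i
  have h2 : Γ' ⊓ cᶜ ≤ ⊥ := le_of_le_compl (inf_le_left.trans hne) key
  rwa [← sdiff_eq, le_bot_iff, sdiff_eq_bot_iff] at h2

/-! ### Pairs -/

theorem le_mem_upair_left (h : Γ ≤ z =ᴮ x) : Γ ≤ z ∈ᴮ upair x y :=
  le_mem_of (y := upair x y) ⟨true⟩ le_top h

theorem le_mem_upair_right (h : Γ ≤ z =ᴮ y) : Γ ≤ z ∈ᴮ upair x y :=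
  le_mem_of (y := upair x y) ⟨false⟩ le_top h

theorem le_of_le_mem_upair {c : 𝔹} (h : Γ ≤ z ∈ᴮ upair x y)
    (hx : ∀ Δ ≤ Γ, Δ ≤ z =ᴮ x → Δ ≤ c) (hy : ∀ Δ ≤ Γ, Δ ≤ z =ᴮ y → Δ ≤ c) : Γ ≤ c := by
  refine le_of_le_mem h ?_
  rintro ⟨i | i⟩ Δ hΔ _ h
  · exact hy Δ hΔ h
  · exact hx Δ hΔ h

theorem le_upair_congr {x' y' : BSet 𝔹} (hx : Γ ≤ x =ᴮ x') (hy : Γ ≤ y =ᴮ y') :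
    Γ ≤ upair x y =ᴮ upair x' y' := by
  refine le_bvEq_of (fun z Δ hΔ hz => le_of_le_mem_upair hz (fun Δ' hΔ' h => ?_) fun Δ' hΔ' h => ?_)
    (fun z Δ hΔ hz => le_of_le_mem_upair hz (fun Δ' hΔ' h => ?_) fun Δ' hΔ' h => ?_)
  · exact le_mem_upair_left (le_bvEq_trans h (hΔ'.trans (hΔ.trans hx)))
  · exact le_mem_upair_right (le_bvEq_trans h (hΔ'.trans (hΔ.trans hy)))
  · exact le_mem_upair_left (le_bvEq_trans h (le_bvEq_symm (hΔ'.trans (hΔ.trans hx))))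
  · exact le_mem_upair_right (le_bvEq_trans h (le_bvEq_symm (hΔ'.trans (hΔ.trans hy))))

theorem le_pair_congr {x' y' : BSet 𝔹} (hx : Γ ≤ x =ᴮ x') (hy : Γ ≤ y =ᴮ y') :
    Γ ≤ pair x y =ᴮ pair x' y' :=
  le_upair_congr (le_upair_congr hx hx) (le_upair_congr hx hy)

theorem le_left_of_pair_eq {x' y' : BSet 𝔹} (h : Γ ≤ pair x y =ᴮ pair x' y') : Γ ≤ x =ᴮ x' := by
  have h1 : Γ ≤ upair x x ∈ᴮ pair x' y' :=
    le_mem_of_eq_right h (le_mem_upair_left (le_bvEq_refl _))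
  refine le_of_le_mem_upair h1 (fun Δ _ h2 => ?_) (fun Δ _ h2 => ?_) <;>
  · have h3 : Δ ≤ x' ∈ᴮ upair x x :=
      le_mem_of_eq_right (le_bvEq_symm h2) (le_mem_upair_left (le_bvEq_refl _))
    exact le_bvEq_symm (le_of_le_mem_upair h3 (fun _ _ h => h) (fun _ _ h => h))

/-- Comparing the second unordered pairs gives `y = x'` or `y = y'`, and by symmetry `y' = x` or `y'
= y`. In the one remaining case `y = x' = x = y'`. -/
theorem le_right_of_pair_eq {x' y' : BSet 𝔹} (h : Γ ≤ pair x y =ᴮ pair x' y') : Γ ≤ y =ᴮ y' := by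
  have key : ∀ {x y x' y' : BSet 𝔹} {Γ : 𝔹}, Γ ≤ pair x y =ᴮ pair x' y' →
      Γ ≤ y =ᴮ x' ⊔ y =ᴮ y' := by
    intro x y x' y' Γ h
    have h1 : Γ ≤ upair x y ∈ᴮ pair x' y' :=
      le_mem_of_eq_right h (le_mem_upair_right (le_bvEq_refl _))
    refine le_of_le_mem_upair h1 (fun Δ _ h2 => ?_) (fun Δ _ h2 => ?_)
    · have h3 : Δ ≤ y ∈ᴮ upair x' x' :=
        le_mem_of_eq_right h2 (le_mem_upair_right (le_bvEq_refl _))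
      exact le_of_le_mem_upair h3 (fun _ _ h => le_sup_of_le_left h)
        (fun _ _ h => le_sup_of_le_left h)
    · have h3 : Δ ≤ y ∈ᴮ upair x' y' :=
        le_mem_of_eq_right h2 (le_mem_upair_right (le_bvEq_refl _))
      exact le_of_le_mem_upair h3 (fun _ _ h => le_sup_of_le_left h)
        (fun _ _ h => le_sup_of_le_right h)
  refine le_of_le_sup (key h) (fun Δ hΔ h1 => ?_) fun Δ _ h1 => h1
  refine le_of_le_sup (key (le_bvEq_symm (hΔ.trans h))) (fun Δ' hΔ' h2 => ?_)
    fun Δ' _ h2 => le_bvEq_symm h2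
  have h3 := le_left_of_pair_eq ((hΔ'.trans hΔ).trans h)
  exact le_bvEq_trans (hΔ'.trans h1) (le_bvEq_trans (le_bvEq_symm h3) (le_bvEq_symm h2))

/-! ### Canonical names -/

variable {p q : PSet.{u}}

theorem le_of_le_mem_check {c : 𝔹} (h : Γ ≤ z ∈ᴮ check p)
    (H : ∀ q ∈ p, ∀ Δ ≤ Γ, Δ ≤ z =ᴮ check q → Δ ≤ c) : Γ ≤ c := by
  cases p with
  | mk α A => exact le_of_le_mem h fun i Δ hΔ _ h2 => H _ (PSet.Mem.mk A i) Δ hΔ h2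

theorem le_check_congr (h : p.Equiv q) : Γ ≤ check p =ᴮ check q := by
  induction p generalizing q Γ with
  | mk α A ih =>
    cases q with
    | mk β B =>
      rw [PSet.Equiv] at h
      refine le_bvEq_of (fun z Δ hΔ hz => ?_) (fun z Δ hΔ hz => ?_)
      · refine le_of_le_mem hz fun i Δ' _ _ h2 => ?_
        obtain ⟨j, hj⟩ := h.1 i
        exact le_mem_of (y := check ⟨β, B⟩) j le_top (le_bvEq_trans h2 (ih i hj))
      · refine le_of_le_mem hz fun j Δ' _ _ h2 => ?_
        obtain ⟨i, hi⟩ := h.2 j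
        exact le_mem_of (y := check ⟨α, A⟩) i le_top (le_bvEq_trans h2 (le_bvEq_symm (ih i hi)))

theorem le_mem_check (h : q ∈ p) (hz : Γ ≤ z =ᴮ check q) : Γ ≤ z ∈ᴮ check p := by
  cases p with
  | mk α A =>
    obtain ⟨i, hi⟩ := h
    exact le_mem_of (y := check ⟨α, A⟩) i le_top (le_bvEq_trans hz (le_check_congr hi))

/-- Equality of canonical names is two-valued. If some `A i` were equivalent to no `B j`, then by
induction every disjunct of "`A i` is a member of `q`" would be `⊥`, and so would `Γ`. -/
theorem equiv_of_le_check_eq (hΓ : Γ ≠ ⊥) (h : Γ ≤ check p =ᴮ check q) : p.Equiv q := by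
  induction p generalizing q Γ with
  | mk α A ih =>
    cases q with
    | mk β B =>
      rw [PSet.Equiv]
      constructor
      · intro i
        by_contra! hi
        refine hΓ (le_bot_iff.1 (le_of_le_mem (le_mem_of_eq_right h
          (le_mem_check (PSet.Mem.mk A i) (le_bvEq_refl _))) fun j Δ _ _ h2 => ?_))
        by_contra hΔ
        exact hi j (ih i (fun h => hΔ h.le) h2)
      · intro j
        by_contra! hj
        refine hΓ (le_bot_iff.1 (le_of_le_mem (le_mem_of_eq_right (le_bvEq_symm h)
          (le_mem_check (PSet.Mem.mk B j) (le_bvEq_refl _))) fun i Δ _ _ h2 => ?_))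
        by_contra hΔ
        exact hj i (ih i (fun h => hΔ h.le) (le_bvEq_symm h2))

theorem mem_of_le_check_mem (hΓ : Γ ≠ ⊥) (h : Γ ≤ check p ∈ᴮ check q) : p ∈ q := by
  by_contra hpq
  refine hΓ (le_bot_iff.1 (le_of_le_mem_check h fun r hr Δ _ h2 => ?_))
  by_contra hΔ
  exact hpq ((PSet.Mem.congr_left (equiv_of_le_check_eq (fun h => hΔ h.le) h2)).2 hr)

theorem le_check_upair : Γ ≤ check {p, q} =ᴮ upair (check p) (check q) := by
  refine le_bvEq_of (fun z Δ _ hz => ?_) (fun z Δ _ hz => ?_)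
  · refine le_of_le_mem_check hz fun r hr Δ' _ h => ?_
    rcases PSet.mem_pair.1 hr with hr | hr
    · exact le_mem_upair_left (le_bvEq_trans h (le_check_congr hr))
    · exact le_mem_upair_right (le_bvEq_trans h (le_check_congr hr))
  · exact le_of_le_mem_upair hz (fun Δ' _ h => le_mem_check (PSet.mem_pair.2 (.inl .rfl)) h)
      (fun Δ' _ h => le_mem_check (PSet.mem_pair.2 (.inr .rfl)) h)

theorem le_check_pair : Γ ≤ check {{p}, {p, q}} =ᴮ pair (check p) (check q) := by
  refine le_bvEq_trans le_check_upair (le_upair_congr ?_ le_check_upair)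
  refine le_bvEq_trans (le_check_congr ?_) le_check_upair
  exact PSet.Mem.ext fun w => by simp

/-- The canonical name of a natural number. -/
def nat (n : ℕ) : BSet 𝔹 := check (PSet.ofNat n)

theorem ofNat_injective {m n : ℕ} (h : (PSet.ofNat.{u} m).Equiv (PSet.ofNat.{u} n)) : m = n := by
  have mono : ∀ n m : ℕ, m < n → PSet.ofNat.{u} m ∈ PSet.ofNat.{u} n := by
    intro n
    induction n with
    | zero => intro m h; omega
    | succ n ih =>
      intro m h
      rcases Nat.lt_succ_iff_lt_or_eq.1 h with h | rfl
      · exact PSet.mem_insert_of_mem _ (ih m h)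
      · exact PSet.mem_insert _ _
  rcases lt_trichotomy m n with h1 | h1 | h1
  · exact absurd ((PSet.Mem.congr_left h).1 (mono _ _ h1)) (PSet.mem_irrefl _)
  · exact h1
  · exact absurd ((PSet.Mem.congr_left h).2 (mono _ _ h1)) (PSet.mem_irrefl _)

theorem eq_of_le_nat_eq {m n : ℕ} (hΓ : Γ ≠ ⊥) (h : Γ ≤ nat m =ᴮ nat n) : m = n :=
  ofNat_injective (equiv_of_le_check_eq hΓ h)

theorem le_nat_mem_omega (n : ℕ) : Γ ≤ nat n ∈ᴮ omega :=
  le_mem_check (PSet.Mem.mk _ (ULift.up n)) (le_bvEq_refl _)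

theorem le_of_le_mem_omega {c : 𝔹} (h : Γ ≤ z ∈ᴮ omega)
    (H : ∀ n, ∀ Δ ≤ Γ, Δ ≤ z =ᴮ nat n → Δ ≤ c) : Γ ≤ c :=
  le_of_le_mem h fun i Δ hΔ _ h2 => H i.down Δ hΔ h2

/-! ### Deciding countably many truth values -/

/-- The name of the characteristic function of the set of natural numbers named by `c`. -/
def charFun (c : ℕ → 𝔹) : BSet 𝔹 :=
  ⟨ULift.{u} ℕ × ULift.{u} Bool, fun i => pair (nat i.1.down) (nat i.2.down.toNat),
    fun i => cond i.2.down (c i.1.down) (c i.1.down)ᶜ⟩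

theorem le_pair_mem_charFun {Γ : 𝔹} {c : ℕ → 𝔹} {n : ℕ} (b : Bool) {x y : BSet 𝔹}
    (h : Γ ≤ cond b (c n) (c n)ᶜ) (hx : Γ ≤ x =ᴮ nat n) (hy : Γ ≤ y =ᴮ nat b.toNat) :
    Γ ≤ pair x y ∈ᴮ charFun c :=
  le_mem_of (y := charFun c) (⟨n⟩, ⟨b⟩) h (le_pair_congr hx hy)

theorem le_of_pair_mem_charFun {Γ d : 𝔹} {c : ℕ → 𝔹} {n : ℕ} {x y : BSet 𝔹}
    (h : Γ ≤ pair x y ∈ᴮ charFun c) (hx : Γ ≤ x =ᴮ nat n)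
    (H : ∀ b : Bool, ∀ Δ ≤ Γ, Δ ≤ cond b (c n) (c n)ᶜ → Δ ≤ y =ᴮ nat b.toNat → Δ ≤ d) :
    Γ ≤ d := by
  refine le_of_le_mem h ?_
  rintro ⟨⟨m⟩, ⟨b⟩⟩ Δ hΔ h1 h2
  -- Facts about canonical names descend to the ground only from a nonzero truth value; below `⊥`
  -- there is nothing to prove. The same case split recurs throughout.
  by_cases hb : Δ = ⊥
  · exact hb ▸ bot_le
  obtain rfl : n = m :=
    eq_of_le_nat_eq hb (le_bvEq_trans (le_bvEq_symm (hΔ.trans hx)) (le_left_of_pair_eq h2))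
  exact H b Δ hΔ h1 (le_right_of_pair_eq h2)

/-- A value exists because `c n ⊔ (c n)ᶜ = ⊤`, and it is unique because `c n ⊓ (c n)ᶜ = ⊥`. -/
theorem isFunc_charFun (c : ℕ → 𝔹) :
    isFunc omega (check {PSet.ofNat 0, PSet.ofNat 1}) (charFun c) = ⊤ := by
  rw [eq_top_iff]
  refine le_inf (le_iInf fun z => le_himp_of fun Γ _ hz => ?_)
    (le_iInf fun a => le_himp_of fun Γ _ ha => ?_)
  · refine le_of_le_mem hz ?_
    rintro ⟨⟨n⟩, ⟨b⟩⟩ Δ _ _ h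
    refine le_iSup_of_le (nat n) (le_iSup_of_le (nat b.toNat)
      (le_inf (le_inf (le_nat_mem_omega n) (le_mem_check ?_ (le_bvEq_refl _))) h))
    cases b
    · exact PSet.mem_pair.2 (.inl .rfl)
    · exact PSet.mem_pair.2 (.inr .rfl)
  · refine le_of_le_mem_omega ha fun n Δ hΔ hn => ?_
    have h0 : Δ ≤ ⨆ b : Bool, cond b (c n) (c n)ᶜ := by
      rw [iSup_bool_eq]; simp
    refine le_of_le_iSup h0 fun b Δ' hΔ' hb => ?_
    refine le_iSup_of_le (nat b.toNat) (le_inf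
      (le_pair_mem_charFun b hb (hΔ'.trans hn) (le_bvEq_refl _))
      (le_iInf fun b' => le_himp_of fun Δ₂ h₂ hb' => ?_))
    refine le_of_pair_mem_charFun hb' (h₂.trans (hΔ'.trans hn)) fun b₂ Δ₃ h₃ h4 h5 => ?_
    have h6 := (h₃.trans h₂).trans hb
    cases b <;> cases b₂
    · exact h5
    · exact le_of_le_compl h6 h4
    · exact le_of_le_compl h4 h6
    · exact h5

/-- The predicate `p` is "`g n = 1`", where `g` is a ground function whose canonical name equals
`charFun c` under `Δ`. -/
theorem le_of_decide_nat (h : ReflectsCountableFunctions 𝔹) {Γ d : 𝔹} (c : ℕ → 𝔹)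
    (H : ∀ p : ℕ → Prop, ∀ Δ ≤ Γ, (∀ n, p n → Δ ≤ c n) → (∀ n, ¬ p n → Δ ≤ (c n)ᶜ) → Δ ≤ d) :
    Γ ≤ d := by
  refine le_of_le_iSup (le_top.trans (h _ _ (isFunc_charFun c)).ge) fun ⟨g, hg⟩ Δ hΔ hgf => ?_
  have key : ∀ n (b : Bool), ({{PSet.ofNat n}, {PSet.ofNat n, PSet.ofNat b.toNat}} : PSet) ∈ g →
      Δ ≤ cond b (c n) (c n)ᶜ := by
    intro n b hn
    refine le_of_pair_mem_charFun (le_mem_of_eq_right hgf (le_mem_check hn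
      (le_bvEq_symm le_check_pair))) (le_bvEq_refl _) fun b' Δ' _ h1 h2 => ?_
    by_cases hb : Δ' = ⊥
    · exact hb ▸ bot_le
    obtain rfl : b = b' := by
      have h3 := eq_of_le_nat_eq hb h2
      cases b <;> cases b' <;> simp_all
    exact h1
  refine H (fun n => ({{PSet.ofNat n}, {PSet.ofNat n, PSet.ofNat 1}} : PSet) ∈ g) Δ hΔ
    (fun n hn => key n true hn) (fun n hn => key n false ?_)
  -- Totality of `g` in the ground provides a value in `{0, 1}`; since `1` is excluded, it is `0`.
  obtain ⟨w, hw, -⟩ := hg.2 (ZFSet.mk (PSet.ofNat n)) (PSet.Mem.mk _ (ULift.up n))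
  have hw2 := (ZFSet.pair_mem_prod.1 (hg.1 hw)).2
  induction w using Quotient.inductionOn with
  | h w =>
    rcases PSet.mem_pair.1 (ZFSet.mk_mem_iff.1 hw2) with h1 | h1
    · rw [ZFSet.mk_eq, ZFSet.eq.2 h1] at hw
      exact hw
    · rw [ZFSet.mk_eq, ZFSet.eq.2 h1] at hw
      exact absurd hw hn

theorem le_of_decide (h : ReflectsCountableFunctions 𝔹) {ι : Type*} [Countable ι] {Γ d : 𝔹}
    (c : ι → 𝔹)
    (H : ∀ p : ι → Prop, ∀ Δ ≤ Γ, (∀ i, p i → Δ ≤ c i) → (∀ i, ¬ p i → Δ ≤ (c i)ᶜ) → Δ ≤ d) :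
    Γ ≤ d := by
  obtain ⟨e, he⟩ := Countable.exists_injective_nat ι
  -- Indices outside the range of `e` are irrelevant; `⊤` is a filler.
  refine le_of_decide_nat h (Function.extend e c fun _ => ⊤) fun p Δ hΔ h1 h2 =>
    H (fun i => p (e i)) Δ hΔ (fun i hi => ?_) (fun i hi => ?_)
  · simpa [he.extend_apply] using h1 (e i) hi
  · simpa [he.extend_apply] using h2 (e i) hi

/-! ### The power set of `ω`. -/

theorem check_powerset_omega (h : ReflectsCountableFunctions 𝔹) :
    (check (PSet.powerset PSet.omega) : BSet 𝔹) =ᴮ powerset omega = ⊤ := by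
  rw [eq_top_iff]
  refine le_bvEq_of (fun z Γ _ hz => ?_) (fun z Γ _ hz => ?_)
  · refine le_of_le_mem_check hz fun q hq Δ hΔ hzq => ?_
    have hq : q ⊆ PSet.omega := PSet.mem_powerset.1 hq
    have hsub : Δ ≤ check q ⊆ᴮ omega := le_subset_of fun w Δ' _ hw =>
      le_of_le_mem_check hw fun r hr _ _ h => le_mem_check (PSet.mem_of_subset hq hr) h
    -- A ground subset of `ω` has a two-valued indicator: the supremum over a proposition is `⊤` or
    -- `⊥` according to its truth.
    have heq : ∀ {Γ : 𝔹}, Γ ≤ check q =ᴮ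
        setOfIndicator omega fun n : ULift ℕ => ⨆ _ : PSet.ofNat n.down ∈ q, ⊤ := by
      intro Γ
      refine le_bvEq_of (fun w Δ _ hw => ?_) (fun w Δ _ hw => ?_)
      · refine le_of_le_mem_check hw fun r hr Δ' _ hwr => ?_
        obtain ⟨n, hn⟩ := PSet.mem_of_subset hq hr
        exact le_mem_of (y := setOfIndicator omega _) n
          (le_iSup_of_le ((PSet.Mem.congr_left hn).1 hr) le_top)
          (le_bvEq_trans hwr (le_check_congr hn))
      · refine le_of_le_mem hw fun n Δ' _ h1 h2 => ?_
        exact le_of_le_iSup h1 fun hn Δ₂ h₂ _ => le_mem_check hn (h₂.trans h2)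
    refine le_mem_of (y := powerset omega)
      (fun n : ULift ℕ => ⨆ _ : PSet.ofNat n.down ∈ q, ⊤) ?_ (le_bvEq_trans hzq heq)
    exact le_subset_of fun w Δ' h' hw =>
      le_mem_of_subset (h'.trans hsub) (le_mem_of_eq_right (le_bvEq_symm heq) hw)
  · refine le_of_le_mem hz fun (χ : ULift ℕ → 𝔹) Δ _ _ hzχ => ?_
    -- Once all values of `χ` are decided by `p`, the name with indicator `χ` equals the canonical
    -- name of `{n | p n}`.
    refine le_of_decide h χ fun p Δ' hΔ' hp hnp => ?_
    refine le_mem_check (q := ⟨ULift {n : ULift ℕ // p n}, fun n => PSet.ofNat n.down.1.down⟩)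
      (PSet.mem_powerset.2 fun n => ⟨n.down.1, .rfl⟩)
      (le_bvEq_trans (hΔ'.trans hzχ) (le_bvEq_of (fun w Δ₂ h₂ hw => ?_) fun w Δ₂ h₂ hw => ?_))
    · refine le_of_le_mem hw fun n Δ₃ h₃ h4 h5 => ?_
      by_cases hn : p n
      · exact le_mem_check ⟨⟨n, hn⟩, .rfl⟩ h5
      · exact le_of_le_compl ((h₃.trans h₂).trans (hnp n hn)) h4
    · refine le_of_le_mem hw fun n Δ₃ h₃ _ h5 => ?_
      exact le_mem_of (y := setOfIndicator omega χ) n.down.1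
        ((h₃.trans h₂).trans (hp _ n.down.2)) h5

/-! ### Collapsing a well-founded relation on the natural numbers -/

/-- The Mostowski collapse of a well-founded relation on the natural numbers. -/
def collapse {S : ℕ → ℕ → Prop} (wf : WellFounded S) : ℕ → PSet.{u} :=
  wf.fix fun n M => ⟨ULift {m // S m n}, fun m => M m.down.1 m.down.2⟩

theorem mem_collapse {S : ℕ → ℕ → Prop} (wf : WellFounded S) {n : ℕ} {q : PSet.{u}} :
    q ∈ collapse.{u} wf n ↔ ∃ m, S m n ∧ q.Equiv (collapse.{u} wf m) := by
  rw [collapse, wf.fix_eq, PSet.mem_def]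
  exact ⟨fun ⟨i, hi⟩ => ⟨i.down.1, i.down.2, hi⟩, fun ⟨m, hm, h⟩ => ⟨⟨m, hm⟩, h⟩⟩

/-- The set of the values of the collapse on `D`. -/
def collapseSet {S : ℕ → ℕ → Prop} (wf : WellFounded S) (D : ℕ → Prop) : PSet.{u} :=
  ⟨ULift {n // D n}, fun n => collapse wf n.down.1⟩

theorem mem_collapseSet {S : ℕ → ℕ → Prop} (wf : WellFounded S) {D : ℕ → Prop} {q : PSet.{u}} :
    q ∈ collapseSet.{u} wf D ↔ ∃ n, D n ∧ q.Equiv (collapse.{u} wf n) :=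
  ⟨fun ⟨i, hi⟩ => ⟨i.down.1, i.down.2, hi⟩, fun ⟨m, hm, h⟩ => ⟨⟨m, hm⟩, h⟩⟩

/-! ### Internal injections into the natural numbers -/

section Inj

variable {Γ c : 𝔹} {η f a a' : BSet 𝔹}

/-- Totality alone yields a value `b` not yet known to lie in `ω`. The first clause of `isFunc`
rewrites the pair as one with second entry in `ω`, which is then a numeral. -/
theorem le_of_isFunc_omega (h : Γ ≤ isFunc η omega f) (ha : Γ ≤ a ∈ᴮ η)
    (H : ∀ n, ∀ Δ ≤ Γ, Δ ≤ pair a (nat n) ∈ᴮ f → Δ ≤ c) : Γ ≤ c := by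
  have h1 := le_of_le_himp ((h.trans inf_le_right).trans (iInf_le _ a)) ha
  refine le_of_le_iSup h1 fun b Δ hΔ hb => ?_
  have hb := hb.trans inf_le_left
  have h2 := le_of_le_himp ((hΔ.trans (h.trans inf_le_left)).trans (iInf_le _ _)) hb
  refine le_of_le_iSup h2 fun a' Δ' hΔ' h3 => le_of_le_iSup h3 fun b' Δ₂ h₂ h4 => ?_
  refine le_of_le_mem_omega (h4.trans (inf_le_left.trans inf_le_right)) fun n Δ₃ h₃ h5 => ?_
  refine H n Δ₃ (h₃.trans (h₂.trans (hΔ'.trans hΔ))) (le_mem_of_eq_left (le_pair_congr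
    (le_bvEq_refl _) (le_bvEq_trans (le_right_of_pair_eq (h₃.trans (h4.trans inf_le_right))) h5))
    ((h₃.trans (h₂.trans hΔ')).trans hb))

theorem le_eq_of_isFunc {x y b b' : BSet 𝔹} (h : Γ ≤ isFunc x y f) (ha : Γ ≤ a ∈ᴮ x)
    (hb : Γ ≤ pair a b ∈ᴮ f) (hb' : Γ ≤ pair a b' ∈ᴮ f) : Γ ≤ b =ᴮ b' := by
  have h1 := le_of_le_himp ((h.trans inf_le_right).trans (iInf_le _ a)) ha
  refine le_of_le_iSup h1 fun d Δ hΔ hd => ?_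
  have hd := hd.trans inf_le_right
  exact le_bvEq_trans (le_of_le_himp (hd.trans (iInf_le _ b)) (hΔ.trans hb))
    (le_bvEq_symm (le_of_le_himp (hd.trans (iInf_le _ b')) (hΔ.trans hb')))

theorem le_eq_of_isInj {x y b : BSet 𝔹} (h : Γ ≤ isInj x y f)
    (hb : Γ ≤ pair a b ∈ᴮ f) (hb' : Γ ≤ pair a' b ∈ᴮ f) : Γ ≤ a =ᴮ a' :=
  le_of_le_himp ((((h.trans inf_le_right).trans (iInf_le _ a)).trans (iInf_le _ a')).trans
    (iInf_le _ b)) (le_inf hb hb')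

/-- The truth value of "`m` and `n` are the images under `f` of elements `a ∈ b` of `η`". -/
def relVal (η f : BSet 𝔹) (m n : ℕ) : 𝔹 :=
  ⨆ a, ⨆ b, a ∈ᴮ η ⊓ b ∈ᴮ η ⊓ a ∈ᴮ b ⊓ pair a (nat m) ∈ᴮ f ⊓ pair b (nat n) ∈ᴮ f

/-- The truth value of "`n` is the image under `f` of an element of `η`". -/
def ranVal (η f : BSet 𝔹) (n : ℕ) : 𝔹 := ⨆ a, a ∈ᴮ η ⊓ pair a (nat n) ∈ᴮ f

theorem le_relVal {m n : ℕ} {b : BSet 𝔹} (ha : Γ ≤ a ∈ᴮ η) (hb : Γ ≤ b ∈ᴮ η) (hab : Γ ≤ a ∈ᴮ b)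
    (hm : Γ ≤ pair a (nat m) ∈ᴮ f) (hn : Γ ≤ pair b (nat n) ∈ᴮ f) : Γ ≤ relVal η f m n :=
  le_iSup_of_le a (le_iSup_of_le b (le_inf (le_inf (le_inf (le_inf ha hb) hab) hm) hn))

theorem le_of_le_relVal {m n : ℕ} (h : Γ ≤ relVal η f m n)
    (H : ∀ a b, ∀ Δ ≤ Γ, Δ ≤ a ∈ᴮ η → Δ ≤ b ∈ᴮ η → Δ ≤ a ∈ᴮ b → Δ ≤ pair a (nat m) ∈ᴮ f →
      Δ ≤ pair b (nat n) ∈ᴮ f → Δ ≤ c) : Γ ≤ c :=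
  le_of_le_iSup h fun a Δ hΔ h1 => le_of_le_iSup h1 fun b Δ' hΔ' h2 => by
    simp only [le_inf_iff] at h2
    exact H a b Δ' (hΔ'.trans hΔ) h2.1.1.1.1 h2.1.1.1.2 h2.1.1.2 h2.1.2 h2.2

theorem le_ranVal {n : ℕ} (ha : Γ ≤ a ∈ᴮ η) (hn : Γ ≤ pair a (nat n) ∈ᴮ f) : Γ ≤ ranVal η f n :=
  le_iSup_of_le a (le_inf ha hn)

theorem le_of_le_ranVal {n : ℕ} (h : Γ ≤ ranVal η f n)
    (H : ∀ a, ∀ Δ ≤ Γ, Δ ≤ a ∈ᴮ η → Δ ≤ pair a (nat n) ∈ᴮ f → Δ ≤ c) : Γ ≤ c :=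
  le_of_le_iSup h fun a Δ hΔ h1 => H a Δ hΔ (h1.trans inf_le_left) (h1.trans inf_le_right)

/-- `Γ` forces that `f` is an injection of the transitive set `η` into `ω` whose range is `D` and
which maps the membership relation of `η` to `S`. -/
structure Decides (Γ : 𝔹) (η f : BSet 𝔹) (S : ℕ → ℕ → Prop) (D : ℕ → Prop) : Prop where
  trans : Γ ≤ isTransitive η
  inj : Γ ≤ isInj η omega f
  rel : ∀ m n, S m n → Γ ≤ relVal η f m n
  not_rel : ∀ m n, ¬ S m n → Γ ≤ (relVal η f m n)ᶜ
  ran : ∀ n, D n → Γ ≤ ranVal η f n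
  not_ran : ∀ n, ¬ D n → Γ ≤ (ranVal η f n)ᶜ

namespace Decides

variable {S : ℕ → ℕ → Prop} {D : ℕ → Prop}

/-- By internal membership induction on `a`, no `a ∈ η` is sent to an inaccessible `k`. Such a `k`
would have an inaccessible predecessor `m`, and injectivity of `f` would place a preimage of `m`
inside `a`. -/
theorem wellFounded (H : Decides Γ η f S D) (hΓ : Γ ≠ ⊥) : WellFounded S := by
  have key := le_of_mem_induction (Γ := Γ)
    (fun a => ⨅ k, ⨅ _ : ¬ Acc S k, (a ∈ᴮ η ⊓ pair a (nat k) ∈ᴮ f)ᶜ) (fun a Δ hΔ ih => ?_)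
  · refine ⟨fun k => by_contra fun hk => ?_⟩
    -- An inaccessible `k` has a predecessor, so it lies in the field of `S` and `rel` supplies a
    -- preimage of it in `η`.
    obtain ⟨m, hm⟩ : ∃ m, S m k := by
      by_contra! hm
      exact hk ⟨_, fun m h => absurd h (hm m)⟩
    refine hΓ (le_bot_iff.1 (le_of_le_relVal (H.rel m k hm) fun a b Δ hΔ _ hb _ _ hbk => ?_))
    exact le_of_le_compl (hΔ.trans ((key b).trans (iInf₂_le k hk))) (le_inf hb hbk)
  · refine le_iInf₂ fun k hk => le_compl_of fun Δ₁ h₁ hak => ?_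
    obtain ⟨m, hmk, hm⟩ : ∃ m, S m k ∧ ¬ Acc S m := by
      by_contra! hm
      exact hk ⟨_, hm⟩
    refine le_of_le_relVal ((h₁.trans hΔ).trans (H.rel m k hmk))
      fun a' b Δ₂ h₂ ha' _ hab hm' hbk => ?_
    have hba : Δ₂ ≤ b =ᴮ a := le_eq_of_isInj (h₂.trans (h₁.trans (hΔ.trans H.inj))) hbk
      (h₂.trans (hak.trans inf_le_right))
    exact le_of_le_compl ((ih a' Δ₂ (h₂.trans h₁) (le_mem_of_eq_right hba hab)).trans
      (iInf₂_le m hm)) (le_inf ha' hm')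

/-- Members of `a` lie in `η` by transitivity, hence have an image `m` under `f`, and `not_rel`
forces `S m k`. Conversely each `m` with `S m k` has a preimage in `a`, by `rel` and injectivity.
The induction hypothesis identifies these preimages with the collapse of `m`. -/
theorem eq_collapse (H : Decides Γ η f S D) (wf : WellFounded S) (k : ℕ) :
    ∀ a, ∀ Δ ≤ Γ, Δ ≤ a ∈ᴮ η → Δ ≤ pair a (nat k) ∈ᴮ f → Δ ≤ a =ᴮ check (collapse wf k) := by
  induction k using wf.induction with
  | _ k ih =>
    intro a Δ hΔ ha hak
    refine le_bvEq_of (fun z Δ₁ h₁ hz => ?_) (fun z Δ₁ h₁ hz => ?_)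
    · have hzη : Δ₁ ≤ z ∈ᴮ η := le_mem_of_subset (le_of_le_himp
        ((h₁.trans (hΔ.trans H.trans)).trans (iInf_le _ a)) (h₁.trans ha)) hz
      refine le_of_isFunc_omega (h₁.trans (hΔ.trans (H.inj.trans inf_le_left))) hzη
        fun m Δ₂ h₂ hm => ?_
      by_cases hmk : S m k
      · exact le_mem_check ((mem_collapse wf).2 ⟨m, hmk, .rfl⟩)
          (ih m hmk z Δ₂ (h₂.trans (h₁.trans hΔ)) (h₂.trans hzη) hm)
      · exact le_of_le_compl ((h₂.trans (h₁.trans hΔ)).trans (H.not_rel m k hmk))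
          (le_relVal (h₂.trans hzη) ((h₂.trans h₁).trans ha) (h₂.trans hz) hm
            ((h₂.trans h₁).trans hak))
    · refine le_of_le_mem_check hz fun q hq Δ₂ h₂ hzq => ?_
      obtain ⟨m, hmk, hqm⟩ := (mem_collapse wf).1 hq
      have hΓ := h₂.trans (h₁.trans hΔ)
      refine le_of_le_relVal (hΓ.trans (H.rel m k hmk)) fun a' b Δ₃ h₃ ha' _ hab hm hbk => ?_
      have hba : Δ₃ ≤ b =ᴮ a := le_eq_of_isInj (h₃.trans (hΓ.trans H.inj)) hbk
        (h₃.trans (h₂.trans (h₁.trans hak)))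
      have h4 := ih m hmk a' Δ₃ (h₃.trans hΓ) ha' hm
      exact le_mem_of_eq_left (le_bvEq_trans h4 (le_bvEq_symm (le_bvEq_trans (h₃.trans hzq)
        (le_check_congr hqm)))) (le_mem_of_eq_right hba hab)

theorem eq_collapseSet (H : Decides Γ η f S D) (wf : WellFounded S) :
    Γ ≤ η =ᴮ check (collapseSet wf D) := by
  refine le_bvEq_of (fun z Δ hΔ hz => ?_) (fun z Δ hΔ hz => ?_)
  · refine le_of_isFunc_omega (hΔ.trans (H.inj.trans inf_le_left)) hz fun n Δ₁ h₁ hn => ?_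
    by_cases hD : D n
    · exact le_mem_check ((mem_collapseSet wf).2 ⟨n, hD, .rfl⟩)
        (H.eq_collapse wf n z Δ₁ (h₁.trans hΔ) (h₁.trans hz) hn)
    · exact le_of_le_compl ((h₁.trans hΔ).trans (H.not_ran n hD)) (le_ranVal (h₁.trans hz) hn)
  · refine le_of_le_mem_check hz fun q hq Δ₁ h₁ hzq => ?_
    obtain ⟨n, hD, hqn⟩ := (mem_collapseSet wf).1 hq
    refine le_of_le_ranVal ((h₁.trans hΔ).trans (H.ran n hD)) fun a Δ₂ h₂ ha hn => ?_
    have h3 := H.eq_collapse wf n a Δ₂ (h₂.trans (h₁.trans hΔ)) ha hn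
    exact le_mem_of_eq_left (le_bvEq_trans h3 (le_bvEq_symm (le_bvEq_trans (h₂.trans hzq)
      (le_check_congr hqn)))) ha

end Decides

end Inj

/-! ### Ordinals -/

section Ord

variable {Γ : 𝔹} {p : PSet.{u}}

theorem le_isOrd_check (h : (ZFSet.mk p).IsOrdinal) : Γ ≤ isOrd (check p) := by
  refine le_inf (le_inf (le_iInf fun y => le_iInf fun z => le_himp_of fun Δ _ hyz => ?_)
    ((isWellFounded_eq_top (𝔹 := 𝔹) _).symm ▸ le_top)) (le_iInf fun y => le_himp_of fun Δ _ hy => ?_)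
  · refine le_of_le_mem_check (hyz.trans inf_le_left) fun q hq Δ₁ h₁ hyq => ?_
    refine le_of_le_mem_check (h₁.trans (hyz.trans inf_le_right)) fun r hr Δ₂ h₂ hzr => ?_
    have hyq := h₂.trans hyq
    rcases (h.mem (ZFSet.mk_mem_iff.2 hq)).mem_trichotomous (h.mem (ZFSet.mk_mem_iff.2 hr)) with
      h3 | h3 | h3
    · exact le_sup_of_le_left (le_sup_of_le_right
        (le_mem_of_eq_right (le_bvEq_symm hzr) (le_mem_check h3 hyq)))
    · exact le_sup_of_le_left (le_sup_of_le_left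
        (le_bvEq_trans hyq (le_bvEq_trans (le_check_congr (ZFSet.eq.1 h3)) (le_bvEq_symm hzr))))
    · exact le_sup_of_le_right
        (le_mem_of_eq_right (le_bvEq_symm hyq) (le_mem_check h3 hzr))
  · refine le_of_le_mem_check hy fun q hq Δ₁ _ hyq => le_subset_of fun z Δ₂ h₂ hz => ?_
    refine le_of_le_mem_check (le_mem_of_eq_right (h₂.trans hyq) hz) fun r hr Δ₃ _ hzr => ?_
    exact le_mem_check (h.mem_trans (ZFSet.mk_mem_iff.2 hr) (ZFSet.mk_mem_iff.2 hq)) hzr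

/-- Transitivity and trichotomy speak only of members of `p`, and equality and membership of
canonical names are two-valued. -/
theorem isOrdinal_of_le_isOrd_check (hΓ : Γ ≠ ⊥) (h : Γ ≤ isOrd (check p)) :
    (ZFSet.mk p).IsOrdinal := by
  have hmem : ∀ {q}, q ∈ p → Γ ≤ check q ∈ᴮ check p := fun hq => le_mem_check hq (le_bvEq_refl _)
  rw [ZFSet.isOrdinal_iff_trichotomous]
  constructor
  · rw [ZFSet.isTransitive_iff_mem_trans]
    intro x y
    refine Quotient.inductionOn₂ x y fun r q hr hq => ?_
    exact mem_of_le_check_mem hΓ (le_mem_of_subset (le_of_le_himp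
      ((h.trans inf_le_right).trans (iInf_le _ _)) (hmem (q := q) hq))
      (le_mem_check hr (le_bvEq_refl _)))
  · refine ⟨?_⟩
    rintro ⟨x, hx⟩ ⟨y, hy⟩ hxy hyx
    revert hx hy
    refine Quotient.inductionOn₂ x y fun q r hq hr hqr hrq => ?_
    have h1 : Γ ≤ check q =ᴮ check r ⊔ check q ∈ᴮ check r ⊔ check r ∈ᴮ check q := le_of_le_himp
      (((h.trans (inf_le_left.trans inf_le_left)).trans (iInf_le _ _)).trans (iInf_le _ _))
      (le_inf (hmem (q := q) hq) (hmem (q := r) hr))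
    by_contra hne
    refine hΓ (le_bot_iff.1 (le_of_le_sup h1 (fun Δ _ h2 => le_of_le_sup h2 (fun Δ' _ h3 => ?_)
      fun Δ' _ h3 => ?_) fun Δ' _ h3 => ?_)) <;> by_contra hΔ
    · exact hne (Subtype.ext (ZFSet.eq.2 (equiv_of_le_check_eq (fun h => hΔ h.le) h3)))
    · exact hqr (mem_of_le_check_mem (fun h => hΔ h.le) h3)
    · exact hrq (mem_of_le_check_mem (fun h => hΔ h.le) h3)

/-- `X` is the von Neumann ordinal of its rank `o`. Choosing for each `a < o` an index at which `v`
takes the value `a` injects `o` into `ℕ`. -/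
theorem mem_toPSet_aleph_one {X : PSet.{u}} (hX : (ZFSet.mk X).IsOrdinal) (v : ℕ → PSet.{u})
    (hv : ∀ q ∈ X, ∃ n, q.Equiv (v n)) : X ∈ (Cardinal.aleph 1).ord.toPSet := by
  have hr := hX.toZFSet_rank_eq
  set o := (ZFSet.mk X).rank with ho
  refine Ordinal.mem_toPSet_iff.2 ⟨o, ?_, ZFSet.eq.1 (hr.symm.trans (Ordinal.mk_toPSet o).symm)⟩
  have h1 : ∀ a : Set.Iio o, ∃ n, a.1.toZFSet = ZFSet.mk (v n) := by
    intro a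
    obtain ⟨n, hn⟩ := hv a.1.toPSet (ZFSet.mk_mem_iff.1 (by
      rw [← hr, Ordinal.mk_toPSet]; exact Ordinal.toZFSet_mem_toZFSet_iff.2 a.2))
    exact ⟨n, by rw [← Ordinal.mk_toPSet]; exact ZFSet.eq.2 hn⟩
  choose e he using h1
  have hinj : Function.Injective fun a : o.ToType => e (Ordinal.ToType.mk.symm a) := by
    intro a b hab
    have h2 := (he (Ordinal.ToType.mk.symm a)).trans
      ((congrArg (fun n => ZFSet.mk (v n)) hab).trans (he (Ordinal.ToType.mk.symm b)).symm)
    exact Ordinal.ToType.mk.symm.injective (Subtype.ext (Ordinal.toZFSet_injective h2))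
  rw [Cardinal.lt_ord, Cardinal.lt_aleph_one_iff, ← Cardinal.mk_toType,
    Cardinal.mk_le_aleph0_iff]
  exact hinj.countable

/-- Internally countable ordinals are canonical names of countable ordinals. -/
theorem le_mem_check_aleph_one (h : ReflectsCountableFunctions 𝔹) {η f : BSet 𝔹}
    (hη : Γ ≤ isOrd η) (hf : Γ ≤ isInj η omega f) :
    Γ ≤ η ∈ᴮ check (Cardinal.aleph 1).ord.toPSet := by
  -- The left summand decides the relation and the right one the range. The range is needed
  -- separately, since for `η = 0` and `η = 1` the relation is empty.
  refine le_of_decide h (ι := (ℕ × ℕ) ⊕ ℕ)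
    (Sum.elim (fun i => relVal η f i.1 i.2) (ranVal η f)) fun P Δ hΔ h1 h2 => ?_
  by_cases hΔ₀ : Δ = ⊥
  · exact hΔ₀ ▸ bot_le
  have H : Decides Δ η f (fun m n => P (.inl (m, n))) (fun n => P (.inr n)) :=
    { trans := hΔ.trans (hη.trans inf_le_right)
      inj := hΔ.trans hf
      rel := fun m n => h1 (.inl (m, n))
      not_rel := fun m n => h2 (.inl (m, n))
      ran := fun n => h1 (.inr n)
      not_ran := fun n => h2 (.inr n) }
  have wf := H.wellFounded hΔ₀
  have heq := H.eq_collapseSet wf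
  refine le_mem_check (mem_toPSet_aleph_one (isOrdinal_of_le_isOrd_check hΔ₀
    ((le_inf heq (hΔ.trans hη)).trans (BExt.isOrd _ _))) (collapse wf) fun q hq => ?_) heq
  obtain ⟨n, -, hn⟩ := (mem_collapseSet wf).1 hq
  exact ⟨n, hn⟩

end Ord

/-! ### Codes of ordinals -/

section Codes

variable {Γ c : 𝔹} {S : ℕ → ℕ → Prop} {z : BSet 𝔹}

/-- The name of a relation on the natural numbers. -/
def relName (S : ℕ → ℕ → Prop) : BSet 𝔹 :=
  setOfIndicator (prod omega omega) fun i : ULift.{u} ℕ × ULift.{u} ℕ =>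
    ⨆ _ : S i.1.down i.2.down, ⊤

theorem le_mem_relName {m n : ℕ} (h : S m n) (hz : Γ ≤ z =ᴮ pair (nat m) (nat n)) :
    Γ ≤ z ∈ᴮ relName S :=
  le_mem_of (y := relName S) ((⟨m⟩, ⟨n⟩) : ULift.{u} ℕ × ULift.{u} ℕ)
    (le_iSup_of_le h le_top) hz

theorem le_of_le_mem_relName (h : Γ ≤ z ∈ᴮ relName S)
    (H : ∀ m n, S m n → ∀ Δ ≤ Γ, Δ ≤ z =ᴮ pair (nat m) (nat n) → Δ ≤ c) : Γ ≤ c :=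
  le_of_le_mem h fun (i : ULift.{u} ℕ × ULift.{u} ℕ) _ hΔ h1 h2 =>
    le_of_le_iSup h1 fun hS Δ' hΔ' _ => H i.1.down i.2.down hS Δ' (hΔ'.trans hΔ) (hΔ'.trans h2)

theorem le_relName_subset : Γ ≤ relName S ⊆ᴮ prod omega omega :=
  le_subset_of fun _ _ _ hw => le_of_le_mem hw fun i _ _ _ h =>
    le_mem_of (y := prod omega omega) i (le_inf le_top le_top) h

theorem le_relVal_of_isMemImage {η f : BSet 𝔹} (h : Γ ≤ isMemImage η f (relName S)) {m n : ℕ}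
    (hS : S m n) : Γ ≤ relVal η f m n := by
  have h1 := (h.trans (iInf_le _ (pair (nat m) (nat n)))).trans inf_le_right
  refine le_of_le_iSup (le_of_le_himp h1 (le_mem_relName hS (le_bvEq_refl _)))
    fun a Δ _ h2 => le_of_le_iSup h2 fun b Δ₁ _ h3 => le_of_le_iSup h3 fun m' Δ₂ _ h4 =>
      le_of_le_iSup h4 fun n' Δ₃ _ h5 => ?_
  simp only [le_inf_iff] at h5
  obtain ⟨⟨⟨⟨⟨ha, hb⟩, hab⟩, hm⟩, hn⟩, hz⟩ := h5
  exact le_relVal ha hb hab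
    (le_mem_of_eq_left (le_pair_congr (le_bvEq_refl _) (le_bvEq_symm (le_left_of_pair_eq hz))) hm)
    (le_mem_of_eq_left (le_pair_congr (le_bvEq_refl _) (le_bvEq_symm (le_right_of_pair_eq hz))) hn)

theorem le_compl_relVal_of_isMemImage {η f : BSet 𝔹} (h : Γ ≤ isMemImage η f (relName S))
    {m n : ℕ} (hS : ¬ S m n) : Γ ≤ (relVal η f m n)ᶜ := by
  refine le_compl_of fun Δ hΔ hr => le_of_le_relVal hr fun a b Δ₁ h₁ ha hb hab hm hn => ?_
  have h1 := (h.trans (iInf_le _ (pair (nat m) (nat n)))).trans inf_le_left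
  have h2 : Δ₁ ≤ pair (nat m) (nat n) ∈ᴮ relName S :=
    le_of_le_himp ((h₁.trans hΔ).trans h1) (le_iSup_of_le a (le_iSup_of_le b
      (le_iSup_of_le (nat m) (le_iSup_of_le (nat n) (le_inf (le_inf (le_inf (le_inf
        (le_inf ha hb) hab) hm) hn) (le_bvEq_refl _))))))
  refine le_of_le_mem_relName h2 fun m' n' hS' Δ₂ _ h3 => ?_
  by_contra hΔ₂
  obtain rfl := eq_of_le_nat_eq (fun h => hΔ₂ h.le) (le_left_of_pair_eq h3)
  obtain rfl := eq_of_le_nat_eq (fun h => hΔ₂ h.le) (le_right_of_pair_eq h3)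
  exact hS hS'

/-- Membership in `relName S` is two-valued, so the relation is already decided. As for the range,
trichotomy compares any `a ∈ η` with the preimage of `m₀`, so its image lies in the field of `S`.
This is where `S` must be nonempty. -/
theorem Decides.of_isMemImage {η f : BSet 𝔹} (hη : Γ ≤ isOrd η) (hf : Γ ≤ isInj η omega f)
    (h : Γ ≤ isMemImage η f (relName S)) {m₀ n₀ : ℕ} (hS : S m₀ n₀) :
    Decides Γ η f S fun n => ∃ m, S m n ∨ S n m where
  trans := hη.trans inf_le_right
  inj := hf
  rel _ _ := le_relVal_of_isMemImage h
  not_rel _ _ := le_compl_relVal_of_isMemImage h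
  ran := by
    rintro n ⟨m, hmn | hnm⟩
    · exact le_of_le_relVal (le_relVal_of_isMemImage h hmn)
        fun a b Δ _ _ hb _ _ hn => le_ranVal hb hn
    · exact le_of_le_relVal (le_relVal_of_isMemImage h hnm)
        fun a b Δ _ ha _ _ hn _ => le_ranVal ha hn
  not_ran := by
    intro n hn
    refine le_compl_of fun Δ hΔ hr => le_of_le_ranVal hr fun a Δ₁ h₁ ha han => ?_
    have h₁ := h₁.trans hΔ
    refine le_of_le_relVal (h₁.trans (le_relVal_of_isMemImage h hS))
      fun b _ Δ₂ h₂ hb _ _ hbm _ => ?_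
    have ha := h₂.trans ha
    have han := h₂.trans han
    have h₂ := h₂.trans h₁
    have htri : Δ₂ ≤ a =ᴮ b ⊔ a ∈ᴮ b ⊔ b ∈ᴮ a := le_of_le_himp ((((h₂.trans hη).trans
      (inf_le_left.trans inf_le_left)).trans (iInf_le _ a)).trans (iInf_le _ b)) (le_inf ha hb)
    refine le_of_le_sup htri (fun Δ₃ h₃ h4 => le_of_le_sup h4 (fun Δ₄ h₄ h5 => ?_)
      fun Δ₄ h₄ h5 => ?_) fun Δ₄ h₄ h5 => ?_
    -- If `a = b`, then `n = m₀`, which is in the field because of `S m₀ n₀`.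
    · have h6 : Δ₄ ≤ nat n =ᴮ nat m₀ := le_eq_of_isFunc
        ((h₄.trans (h₃.trans (h₂.trans hf))).trans inf_le_left) (h₄.trans (h₃.trans ha))
        (h₄.trans (h₃.trans han)) (le_mem_of_eq_left (le_pair_congr (le_bvEq_symm h5)
          (le_bvEq_refl _)) (h₄.trans (h₃.trans hbm)))
      by_contra hΔ₄
      exact hn (eq_of_le_nat_eq (fun h => hΔ₄ h.le) h6 ▸ ⟨n₀, .inr hS⟩)
    · have h₄ := h₄.trans h₃
      exact le_of_le_compl (h₄.trans (h₂.trans (le_compl_relVal_of_isMemImage h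
          fun h' => hn ⟨m₀, .inr h'⟩)))
        (le_relVal (h₄.trans ha) (h₄.trans hb) h5 (h₄.trans han) (h₄.trans hbm))
    · exact le_of_le_compl (h₄.trans (h₂.trans (le_compl_relVal_of_isMemImage h
          fun h' => hn ⟨m₀, .inl h'⟩)))
        (le_relVal (h₄.trans hb) (h₄.trans ha) h5 (h₄.trans hbm) (h₄.trans han))

/-- A nonempty relation on the natural numbers codes at most one ordinal. -/
theorem le_eq_of_le_codes {m₀ n₀ : ℕ} (hS : S m₀ n₀) {η η' : BSet 𝔹}
    (h : Γ ≤ codes (relName S) η) (h' : Γ ≤ codes (relName S) η') : Γ ≤ η =ᴮ η' := by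
  refine le_of_le_iSup (h.trans inf_le_right) fun f Δ hΔ hf => ?_
  refine le_of_le_iSup (hΔ.trans (h'.trans inf_le_right)) fun f' Δ' hΔ' hf' => ?_
  have hf := hΔ'.trans hf
  have hΔ := hΔ'.trans hΔ
  by_cases hΔ₀ : Δ' = ⊥
  · exact hΔ₀ ▸ bot_le
  have H := Decides.of_isMemImage (hΔ.trans (h.trans inf_le_left)) (hf.trans inf_le_left)
    (hf.trans inf_le_right) hS
  have H' := Decides.of_isMemImage (hΔ.trans (h'.trans inf_le_left)) (hf'.trans inf_le_left)
    (hf'.trans inf_le_right) hS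
  have wf := H.wellFounded hΔ₀
  -- Both ordinals are the collapse of the same `S` on the same field.
  exact le_bvEq_trans (H.eq_collapseSet wf) (le_bvEq_symm (H'.eq_collapseSet wf))

/-- The name of the function on `p` with values `g`. -/
def funName (p : PSet.{u}) (g : p.Type → ℕ) : BSet 𝔹 :=
  ⟨p.Type, fun i => pair (check (p.Func i)) (nat (g i)), fun _ => ⊤⟩

variable {p : PSet.{u}} {g : p.Type → ℕ}

theorem le_pair_mem_funName {x y : BSet 𝔹} (i : p.Type) (hx : Γ ≤ x =ᴮ check (p.Func i))
    (hy : Γ ≤ y =ᴮ nat (g i)) : Γ ≤ pair x y ∈ᴮ funName p g :=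
  le_mem_of (y := funName p g) i le_top (le_pair_congr hx hy)

theorem le_of_pair_mem_funName {x y : BSet 𝔹} (h : Γ ≤ pair x y ∈ᴮ funName p g)
    (H : ∀ i, ∀ Δ ≤ Γ, Δ ≤ x =ᴮ check (p.Func i) → Δ ≤ y =ᴮ nat (g i) → Δ ≤ c) : Γ ≤ c :=
  le_of_le_mem h fun i Δ hΔ _ h2 => H i Δ hΔ (le_left_of_pair_eq h2) (le_right_of_pair_eq h2)

/-- A pre-set may list a member under several indices. One direction of `hg` makes the name
single-valued, the other makes it injective. -/
theorem le_isInj_funName (hg : ∀ i j, g i = g j ↔ (p.Func i).Equiv (p.Func j)) :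
    Γ ≤ isInj (check p) omega (funName p g) := by
  refine le_inf (le_inf (le_iInf fun z => le_himp_of fun Δ _ hz => ?_)
    (le_iInf fun a => le_himp_of fun Δ _ ha => ?_))
    (le_iInf fun a => le_iInf fun a' => le_iInf fun b => le_himp_of fun Δ _ h => ?_)
  · refine le_of_le_mem hz fun i Δ' _ _ h => ?_
    exact le_iSup_of_le (check (p.Func i)) (le_iSup_of_le (nat (g i)) (le_inf (le_inf
      (le_mem_check (PSet.func_mem p i) (le_bvEq_refl _)) (le_nat_mem_omega _)) h))
  · refine le_of_le_mem_check ha fun q ⟨i, hi⟩ Δ' _ haq => ?_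
    have hai : Δ' ≤ a =ᴮ check (p.Func i) := le_bvEq_trans haq (le_check_congr hi)
    refine le_iSup_of_le (nat (g i)) (le_inf (le_pair_mem_funName i hai (le_bvEq_refl _))
      (le_iInf fun b' => le_himp_of fun Δ₁ h₁ hb' => ?_))
    refine le_of_pair_mem_funName hb' fun j Δ₂ h₂ haj hbj => ?_
    by_cases hΔ : Δ₂ = ⊥
    · exact hΔ ▸ bot_le
    have := equiv_of_le_check_eq hΔ (le_bvEq_trans (le_bvEq_symm ((h₂.trans h₁).trans hai)) haj)
    rwa [(hg i j).2 this]
  · refine le_of_pair_mem_funName (h.trans inf_le_left) fun i Δ₁ h₁ hai hbi => ?_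
    refine le_of_pair_mem_funName (h₁.trans (h.trans inf_le_right)) fun j Δ₂ h₂ haj hbj => ?_
    by_cases hΔ : Δ₂ = ⊥
    · exact hΔ ▸ bot_le
    have := eq_of_le_nat_eq hΔ (le_bvEq_trans (le_bvEq_symm (h₂.trans hbi)) hbj)
    exact le_bvEq_trans (h₂.trans hai)
      (le_bvEq_trans (le_check_congr ((hg i j).1 this)) (le_bvEq_symm haj))

theorem le_codes_check (hp : (ZFSet.mk p).IsOrdinal)
    (hg : ∀ i j, g i = g j ↔ (p.Func i).Equiv (p.Func j)) :
    Γ ≤ codes (relName fun m n => ∃ i j, p.Func i ∈ p.Func j ∧ g i = m ∧ g j = n) (check p) := by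
  refine le_inf (le_isOrd_check hp) (le_iSup_of_le (funName p g) (le_inf (le_isInj_funName hg)
    (le_iInf fun z => le_inf (le_himp_of fun Δ _ hz => ?_) (le_himp_of fun Δ _ hz => ?_))))
  · refine le_of_le_iSup hz fun a Δ₁ _ h => le_of_le_iSup h fun b Δ₂ _ h =>
      le_of_le_iSup h fun m Δ₃ _ h => le_of_le_iSup h fun n Δ₄ _ h => ?_
    simp only [le_inf_iff] at h
    obtain ⟨⟨⟨⟨-, hab⟩, hm⟩, hn⟩, hz⟩ := h
    refine le_of_pair_mem_funName hm fun i Δ₅ h₅ hai hmi => ?_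
    refine le_of_pair_mem_funName (h₅.trans hn) fun j Δ₆ h₆ hbj hnj => ?_
    by_cases hΔ : Δ₆ = ⊥
    · exact hΔ ▸ bot_le
    have h56 := h₆.trans h₅
    have hij := mem_of_le_check_mem hΔ
      (le_mem_of_eq_left (h₆.trans hai) (le_mem_of_eq_right hbj (h56.trans hab)))
    exact le_mem_relName ⟨i, j, hij, rfl, rfl⟩
      (le_bvEq_trans (h56.trans hz) (le_pair_congr (h₆.trans hmi) hnj))
  · refine le_of_le_mem_relName hz fun m n ⟨i, j, hij, hi, hj⟩ Δ₁ _ h => ?_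
    subst hi hj
    refine le_iSup_of_le (check (p.Func i)) (le_iSup_of_le (check (p.Func j))
      (le_iSup_of_le (nat (g i)) (le_iSup_of_le (nat (g j)) (le_inf (le_inf (le_inf (le_inf
        (le_inf ?_ ?_) ?_) ?_) ?_) h))))
    · exact le_mem_check (PSet.func_mem p i) (le_bvEq_refl _)
    · exact le_mem_check (PSet.func_mem p j) (le_bvEq_refl _)
    · exact le_mem_check hij (le_bvEq_refl _)
    · exact le_pair_mem_funName i (le_bvEq_refl _) (le_bvEq_refl _)
    · exact le_pair_mem_funName j (le_bvEq_refl _) (le_bvEq_refl _)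

end Codes

/-! ### The internal `ℵ₁` -/

theorem codes_codedOrd (R : BSet 𝔹) : codes R (codedOrd R) = ⨆ η, codes R η :=
  (maximum_principle (codes R) (BExt.codes R)).choose_spec

theorem toPSet_zero_equiv : (Ordinal.toPSet.{u} 0).Equiv (PSet.ofNat.{u} 0) :=
  ZFSet.eq.1 ((Ordinal.mk_toPSet 0).trans Ordinal.toZFSet_zero)

theorem toPSet_one_equiv : (Ordinal.toPSet.{u} 1).Equiv (PSet.ofNat.{u} 1) := by
  refine ZFSet.eq.1 ((Ordinal.mk_toPSet 1).trans ?_)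
  rw [← zero_add (1 : Ordinal), Ordinal.toZFSet_add_one, Ordinal.toZFSet_zero]
  rfl

theorem toPSet_equiv_iff {a b : Ordinal.{u}} : a.toPSet.Equiv b.toPSet ↔ a = b := by
  rw [← ZFSet.eq, Ordinal.mk_toPSet, Ordinal.mk_toPSet, Ordinal.toZFSet_injective.eq_iff]

/-- For `o ≥ 2`, an injection of `o` into `ℕ` gives a ground code `S`, and uniqueness of the coded
ordinal identifies `codedOrd (relName S)` with the canonical name of `o`. Uniqueness fails for the
empty relation, so `0` and `1` rely on the two inserted elements. -/
theorem le_check_toPSet_mem_alephOne {Γ : 𝔹} {o : Ordinal.{u}}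
    (ho : o < (Cardinal.aleph 1).ord) : Γ ≤ check o.toPSet ∈ᴮ alephOne := by
  rcases eq_zero_or_pos o with rfl | h0
  · exact le_mem_of (y := alephOne) (none : Option _) le_top (le_check_congr toPSet_zero_equiv)
  rcases (Order.one_le_iff_pos.2 h0).eq_or_lt with rfl | h1
  · exact le_mem_of (y := alephOne) (some none : Option (Option _)) le_top
      (le_check_congr toPSet_one_equiv)
  have hc : Countable o.ToType := by
    rwa [← Cardinal.mk_le_aleph0_iff, Cardinal.mk_toType, ← Cardinal.lt_aleph_one_iff,
      ← Cardinal.lt_ord]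
  obtain ⟨e, he⟩ := Countable.exists_injective_nat o.ToType
  have hex : ∀ i, ∃ a : Set.Iio o, (o.toPSet.Func i).Equiv a.1.toPSet := fun i => by
    obtain ⟨a, ha, h⟩ := Ordinal.mem_toPSet_iff.1 (PSet.func_mem _ i)
    exact ⟨⟨a, ha⟩, h⟩
  choose a ha using hex
  have hg : ∀ i j, e (.mk (a i)) = e (.mk (a j)) ↔
      (o.toPSet.Func i).Equiv (o.toPSet.Func j) := by
    intro i j
    rw [he.eq_iff, Ordinal.ToType.mk.injective.eq_iff, Subtype.ext_iff, ← toPSet_equiv_iff]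
    exact ⟨fun h => (ha i).trans (h.trans (ha j).symm), fun h => (ha i).symm.trans (h.trans (ha j))⟩
  have hord : (ZFSet.mk o.toPSet).IsOrdinal := by
    rw [Ordinal.mk_toPSet]; exact ZFSet.isOrdinal_toZFSet o
  set S : ℕ → ℕ → Prop := fun m n => ∃ i j, o.toPSet.Func i ∈ o.toPSet.Func j ∧
    e (.mk (a i)) = m ∧ e (.mk (a j)) = n
  have hcodes : Γ ≤ codes (relName S) (check o.toPSet) := le_codes_check hord hg
  -- The members `0 ∈ 1` of `o` witness that `S` is nonempty.
  obtain ⟨i, hi⟩ := Ordinal.mem_toPSet_iff.2 ⟨0, h0, .rfl⟩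
  obtain ⟨j, hj⟩ := Ordinal.mem_toPSet_iff.2 ⟨1, h1, .rfl⟩
  have hij : o.toPSet.Func i ∈ o.toPSet.Func j :=
    (PSet.Mem.congr_left hi).1 ((PSet.Mem.congr_right hj).1
      (Ordinal.mem_toPSet_iff.2 ⟨0, zero_lt_one, .rfl⟩))
  have hsup : Γ ≤ ⨆ η, codes (relName S) η := le_iSup_of_le _ hcodes
  -- The index is the indicator defining `relName S`, viewed in the index type of the power set of
  -- `ω × ω`.
  refine le_mem_of (y := alephOne)
    (some (some (fun i : ULift.{u} ℕ × ULift.{u} ℕ => ⨆ _ : S i.1.down i.2.down, ⊤)) :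
      Option (Option (ULift.{u} ℕ × ULift.{u} ℕ → 𝔹))) (le_inf le_relName_subset hsup) ?_
  exact le_eq_of_le_codes ⟨i, j, hij, rfl, rfl⟩ hcodes (hsup.trans (codes_codedOrd _).ge)

theorem check_aleph_one (h : ReflectsCountableFunctions 𝔹) :
    (check (Cardinal.aleph 1).ord.toPSet : BSet 𝔹) =ᴮ alephOne = ⊤ := by
  have hlt : (1 : Ordinal.{u}) < (Cardinal.aleph 1).ord := by
    rw [Cardinal.lt_ord, Ordinal.card_one]
    exact Cardinal.one_lt_aleph0.trans Cardinal.aleph0_lt_aleph_one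
  rw [eq_top_iff]
  refine le_bvEq_of (fun z Γ _ hz => ?_) (fun z Γ _ hz => ?_)
  · refine le_of_le_mem_check hz fun q hq Δ _ hzq => ?_
    obtain ⟨o, ho, hqo⟩ := Ordinal.mem_toPSet_iff.1 hq
    exact le_mem_of_eq_left (le_bvEq_symm (le_bvEq_trans hzq (le_check_congr hqo)))
      (le_check_toPSet_mem_alephOne ho)
  · refine le_of_le_mem hz ?_
    rintro (_ | _ | χ) Δ _ h1 h2
    · exact le_mem_check (Ordinal.mem_toPSet_iff.2
        ⟨0, zero_lt_one.trans hlt, toPSet_zero_equiv.symm⟩) h2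
    · exact le_mem_check (Ordinal.mem_toPSet_iff.2 ⟨1, hlt, toPSet_one_equiv.symm⟩) h2
    -- The truth value attached to a code is at most the supremum that `codedOrd` attains, so below
    -- it the chosen name is an ordinal with an injection into `ω`.
    · have h3 := (h1.trans inf_le_right).trans (codes_codedOrd _).ge
      refine le_of_le_iSup (h3.trans inf_le_right) fun f Δ' hΔ' hf => ?_
      exact le_mem_of_eq_left (le_bvEq_symm (hΔ'.trans h2)) (le_mem_check_aleph_one h
        (hΔ'.trans (h3.trans inf_le_left)) (hf.trans inf_le_left))

end BSet

theorem mainTheorem6 (𝔹 : Type u) [CompleteBooleanAlgebra 𝔹]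
    (h : BSet.ReflectsCountableFunctions 𝔹) :
    (BSet.check (PSet.powerset PSet.omega) : BSet 𝔹) =ᴮ BSet.powerset BSet.omega = ⊤ ∧
    (BSet.check (Cardinal.aleph 1).ord.toPSet : BSet 𝔹) =ᴮ BSet.alephOne = ⊤ :=
  ⟨BSet.check_powerset_omega h, BSet.check_aleph_one h⟩
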